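/- Let $c_{00}$ be the space of finitely supported real sequences indexed by $\mathbb{N}=\{1,2,\dots\}$, with unit vectors $(e_i)_{i\ge 1}$, and for $E\subset\mathbb{N}$ and $x\in c_{00}$ let $Ex$ be the projection of $x$ onto the coordinates in $E$. Let $\mathcal{S}_1=\{F\subset\mathbb{N}\text{ finite, nonempty}: \operatorname{card}F\le\min F\}\cup\{\emptyset\}$. For $\theta\in(0,1)$ define norms on $c_{00}$ by letting $\|x\|_0$ be the supremum norm and $$\|x\|_{k+1}=\max\Big\{\|x\|_k,\ \sup\Big\{\theta\sum_{i=1}^d\|E_ix\|_k : E_1<\dots<E_d,\ \{\min E_1,\dots,\min E_d\}\in\mathcal{S}_1\Big\}\Big\},$$ where the $E_i$ are nonempty finite subsets of $\mathbb{N}$ and $E<F$ means $\max E<\min F$. Put $\|x\|=\sup_k\|x\|_k$, and let $T[\theta,\mathcal{S}_1]$ be the real Banach space obtained as the completion of $(c_{00},\|\cdot\|)$. Theorem. Let $n\ge 2$ be an integer. A bounded linear operator $U$ on $T[\frac1n,\mathcal{S}_1]$ is a surjective isometry if and only if there are a permutation $\pi$ of $\{1,\dots,n\}$ and signs $(\varepsilon_i)_{i=1}^\infty\subset\{\pm1\}$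 such that $Ue_i=\varepsilon_ie_{\pi(i)}$ for $1\le i\le n$ and $Ue_i=\varepsilon_ie_i$ for all $i\ge n+1$. Moreover, for every such $\pi$ and $(\varepsilon_i)$ there is a surjective linear isometry $U$ of $T[\frac1n,\mathcal{S}_1]$ with these values on the unit vectors. -/

import Mathlib

open scoped BigOperators

noncomputable section

namespace Tsirelson

/-- The Schreier family `S₁` of finite sets `F` of positive integers with `card F ≤ min F`,
together with the empty set. -/
def schreier : Set (Finset ℕ+) :=
  {F | ∀ h : F.Nonempty, F.card ≤ (F.min' h : ℕ)}

/-- `E₁ < ⋯ < E_d` (that is, `max E_i < min E_j` for `i < j`) are nonempty finite sets of positive integers, and the set of their minima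
belongs to the family `𝓕`. -/
def Admissible (𝓕 : Set (Finset ℕ+)) {d : ℕ} (E : Fin d → Finset ℕ+) : Prop :=
  ∃ h : ∀ i, (E i).Nonempty,
    (∀ i j, i < j → (E i).max' (h i) < (E j).min' (h j)) ∧
      (Finset.univ.image fun i => (E i).min' (h i)) ∈ 𝓕

/-- The coordinate projection `E x` of a finitely supported sequence `x`. -/
def proj (E : Finset ℕ+) (x : ℕ+ →₀ ℝ) : ℕ+ →₀ ℝ :=
  x.filter (· ∈ E)

/-- The norms `‖·‖_k`, `k = 0, 1, 2, …`, on `c₀₀` whose supremum is the norm of `T[θ, 𝓕]`. -/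
def levelNorm (θ : ℝ) (𝓕 : Set (Finset ℕ+)) : ℕ → (ℕ+ →₀ ℝ) → ℝ
  | 0, x => ⨆ i, |x i|
  | k + 1, x => max (levelNorm θ 𝓕 k x)
      (sSup {r | ∃ (d : ℕ) (E : Fin d → Finset ℕ+), Admissible 𝓕 E ∧
        r = θ * ∑ i, levelNorm θ 𝓕 k (proj (E i) x)})

/-- The norm of `T[θ, 𝓕]` on finitely supported sequences. -/
def tNorm (θ : ℝ) (𝓕 : Set (Finset ℕ+)) (x : ℕ+ →₀ ℝ) : ℝ :=
  ⨆ k, levelNorm θ 𝓕 k x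

/-! ### The suprema are finite and `tNorm` is a norm -/

/-- The `ℓ₁` norm, an upper bound for all the norms above. -/
def l1 (x : ℕ+ →₀ ℝ) : ℝ := ∑ i ∈ x.support, |x i|

theorem proj_apply (E : Finset ℕ+) (x : ℕ+ →₀ ℝ) (i : ℕ+) :
    proj E x i = if i ∈ E then x i else 0 := by
  simp [proj, Finsupp.filter_apply]

theorem proj_add (E : Finset ℕ+) (x y : ℕ+ →₀ ℝ) :
    proj E (x + y) = proj E x + proj E y := by
  ext i
  simp only [proj_apply, Finsupp.add_apply]
  split_ifs <;> simp

theorem proj_smul (E : Finset ℕ+) (c : ℝ) (x : ℕ+ →₀ ℝ) :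
    proj E (c • x) = c • proj E x := by
  ext i
  simp [proj_apply]

theorem l1_eq_sum {x : ℕ+ →₀ ℝ} {s : Finset ℕ+} (h : x.support ⊆ s) :
    l1 x = ∑ i ∈ s, |x i| := by
  refine Finset.sum_subset h ?_
  intro i _ hi
  simp [Finsupp.notMem_support_iff.mp hi]

theorem l1_nonneg (x : ℕ+ →₀ ℝ) : 0 ≤ l1 x :=
  Finset.sum_nonneg fun _ _ => abs_nonneg _

theorem abs_le_l1 (x : ℕ+ →₀ ℝ) (i : ℕ+) : |x i| ≤ l1 x := by
  by_cases hi : i ∈ x.support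
  · exact Finset.single_le_sum (f := fun i => |x i|) (fun _ _ => abs_nonneg _) hi
  · rw [Finsupp.notMem_support_iff.mp hi, abs_zero]
    exact l1_nonneg x

theorem sum_l1_proj_le {𝓕 : Set (Finset ℕ+)} {d : ℕ} {E : Fin d → Finset ℕ+}
    (hE : Admissible 𝓕 E) (x : ℕ+ →₀ ℝ) : ∑ i, l1 (proj (E i) x) ≤ l1 x := by
  obtain ⟨h, hlt, -⟩ := hE
  have key : ∀ i j m, i < j → m ∈ E i → m ∈ E j → False := fun i j m hij hi hj =>
    absurd (hlt i j hij)
      (not_lt.mpr (((E j).min'_le m hj).trans ((E i).le_max' m hi)))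
  have h1 : ∀ i, l1 (proj (E i) x) = ∑ m ∈ x.support, |proj (E i) x m| := fun i =>
    l1_eq_sum (by
      intro m hm
      rw [Finsupp.mem_support_iff, proj_apply] at hm
      rw [Finsupp.mem_support_iff]
      intro h0
      simp [h0] at hm)
  simp only [h1]
  rw [Finset.sum_comm]
  refine Finset.sum_le_sum fun m _ => ?_
  by_cases hm : ∃ i, m ∈ E i
  · obtain ⟨i, hi⟩ := hm
    rw [Finset.sum_eq_single i]
    · simp [proj_apply, hi]
    · intro j _ hj
      have : m ∉ E j := fun hmj => by
        rcases lt_or_gt_of_ne hj with hlt' | hlt'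
        · exact key j i m hlt' hmj hi
        · exact key i j m hlt' hi hmj
      simp [proj_apply, this]
    · simp
  · push Not at hm
    simp [proj_apply, hm]

section

variable {θ : ℝ} {𝓕 : Set (Finset ℕ+)}

theorem bddAbove_abs (x : ℕ+ →₀ ℝ) : BddAbove (Set.range fun i => |x i|) :=
  ⟨l1 x, by rintro _ ⟨i, rfl⟩; exact abs_le_l1 x i⟩

theorem levelNorm_nonneg (k : ℕ) (x : ℕ+ →₀ ℝ) : 0 ≤ levelNorm θ 𝓕 k x := by
  induction k with
  | zero => exact Real.iSup_nonneg fun i => abs_nonneg _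
  | succ k ih => exact le_max_of_le_left ih

theorem levelNorm_le_l1 (_h0 : 0 ≤ θ) (h1 : θ ≤ 1) (k : ℕ) (x : ℕ+ →₀ ℝ) :
    levelNorm θ 𝓕 k x ≤ l1 x := by
  induction k generalizing x with
  | zero => exact ciSup_le fun i => abs_le_l1 x i
  | succ k ih =>
    refine max_le (ih x) (Real.sSup_le ?_ (l1_nonneg x))
    rintro r ⟨d, E, hE, rfl⟩
    have hs : ∑ i, levelNorm θ 𝓕 k (proj (E i) x) ≤ l1 x :=
      (Finset.sum_le_sum fun i _ => ih _).trans (sum_l1_proj_le hE x)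
    have hn : 0 ≤ ∑ i, levelNorm θ 𝓕 k (proj (E i) x) :=
      Finset.sum_nonneg fun i _ => levelNorm_nonneg k _
    nlinarith

theorem bddAbove_step (h0 : 0 ≤ θ) (h1 : θ ≤ 1) (k : ℕ) (x : ℕ+ →₀ ℝ) :
    BddAbove {r | ∃ (d : ℕ) (E : Fin d → Finset ℕ+), Admissible 𝓕 E ∧
        r = θ * ∑ i, levelNorm θ 𝓕 k (proj (E i) x)} := by
  refine ⟨l1 x, ?_⟩
  rintro r ⟨d, E, hE, rfl⟩
  have hs : ∑ i, levelNorm θ 𝓕 k (proj (E i) x) ≤ l1 x :=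
    (Finset.sum_le_sum fun i _ => levelNorm_le_l1 h0 h1 k _).trans (sum_l1_proj_le hE x)
  have hn : 0 ≤ ∑ i, levelNorm θ 𝓕 k (proj (E i) x) :=
    Finset.sum_nonneg fun i _ => levelNorm_nonneg k _
  nlinarith

theorem levelNorm_add_le (h0 : 0 ≤ θ) (h1 : θ ≤ 1) (k : ℕ) (x y : ℕ+ →₀ ℝ) :
    levelNorm θ 𝓕 k (x + y) ≤ levelNorm θ 𝓕 k x + levelNorm θ 𝓕 k y := by
  induction k generalizing x y with
  | zero =>
    refine ciSup_le fun i => (abs_add_le _ _).trans ?_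
    exact add_le_add (le_ciSup (bddAbove_abs x) i) (le_ciSup (bddAbove_abs y) i)
  | succ k ih =>
    refine max_le ((ih x y).trans (add_le_add (le_max_left _ _) (le_max_left _ _)))
      (Real.sSup_le ?_ (add_nonneg (levelNorm_nonneg (k + 1) x) (levelNorm_nonneg (k + 1) y)))
    rintro r ⟨d, E, hE, rfl⟩
    have hx := (le_csSup (bddAbove_step (𝓕 := 𝓕) h0 h1 k x) ⟨d, E, hE, rfl⟩).trans
      (le_max_right (levelNorm θ 𝓕 k x) _)
    have hy := (le_csSup (bddAbove_step (𝓕 := 𝓕) h0 h1 k y) ⟨d, E, hE, rfl⟩).trans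
      (le_max_right (levelNorm θ 𝓕 k y) _)
    refine le_trans ?_ (add_le_add hx hy)
    rw [← mul_add, ← Finset.sum_add_distrib]
    refine mul_le_mul_of_nonneg_left (Finset.sum_le_sum fun i _ => ?_) h0
    rw [proj_add]
    exact ih _ _

theorem levelNorm_smul_le (h0 : 0 ≤ θ) (h1 : θ ≤ 1) (k : ℕ) (c : ℝ) (x : ℕ+ →₀ ℝ) :
    levelNorm θ 𝓕 k (c • x) ≤ |c| * levelNorm θ 𝓕 k x := by
  induction k generalizing x with
  | zero =>
    refine ciSup_le fun i => ?_
    rw [Finsupp.smul_apply, smul_eq_mul, abs_mul]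
    exact mul_le_mul_of_nonneg_left (le_ciSup (bddAbove_abs x) i) (abs_nonneg c)
  | succ k ih =>
    refine max_le ((ih x).trans (mul_le_mul_of_nonneg_left (le_max_left _ _) (abs_nonneg c)))
      (Real.sSup_le ?_ (mul_nonneg (abs_nonneg c) (levelNorm_nonneg (k + 1) x)))
    rintro r ⟨d, E, hE, rfl⟩
    have hx := (le_csSup (bddAbove_step (𝓕 := 𝓕) h0 h1 k x) ⟨d, E, hE, rfl⟩).trans
      (le_max_right (levelNorm θ 𝓕 k x) _)
    refine le_trans ?_ (mul_le_mul_of_nonneg_left hx (abs_nonneg c))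
    rw [mul_left_comm, Finset.mul_sum _ _ |c|]
    refine mul_le_mul_of_nonneg_left (Finset.sum_le_sum fun i _ => ?_) h0
    rw [proj_smul]
    exact ih _

theorem bddAbove_levelNorm (h0 : 0 ≤ θ) (h1 : θ ≤ 1) (x : ℕ+ →₀ ℝ) :
    BddAbove (Set.range fun k => levelNorm θ 𝓕 k x) :=
  ⟨l1 x, by rintro _ ⟨k, rfl⟩; exact levelNorm_le_l1 h0 h1 k x⟩

theorem tNorm_nonneg (x : ℕ+ →₀ ℝ) : 0 ≤ tNorm θ 𝓕 x :=
  Real.iSup_nonneg fun k => levelNorm_nonneg k x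

theorem abs_le_tNorm (h0 : 0 ≤ θ) (h1 : θ ≤ 1) (x : ℕ+ →₀ ℝ) (i : ℕ+) :
    |x i| ≤ tNorm θ 𝓕 x :=
  (le_ciSup (bddAbove_abs x) i).trans (le_ciSup (bddAbove_levelNorm (𝓕 := 𝓕) h0 h1 x) 0)

theorem tNorm_add_le (h0 : 0 ≤ θ) (h1 : θ ≤ 1) (x y : ℕ+ →₀ ℝ) :
    tNorm θ 𝓕 (x + y) ≤ tNorm θ 𝓕 x + tNorm θ 𝓕 y :=
  ciSup_le fun k => (levelNorm_add_le h0 h1 k x y).trans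
    (add_le_add (le_ciSup (bddAbove_levelNorm h0 h1 x) k)
      (le_ciSup (bddAbove_levelNorm h0 h1 y) k))

theorem tNorm_smul_le (h0 : 0 ≤ θ) (h1 : θ ≤ 1) (c : ℝ) (x : ℕ+ →₀ ℝ) :
    tNorm θ 𝓕 (c • x) ≤ |c| * tNorm θ 𝓕 x :=
  ciSup_le fun k => (levelNorm_smul_le h0 h1 k c x).trans
    (mul_le_mul_of_nonneg_left (le_ciSup (bddAbove_levelNorm h0 h1 x) k) (abs_nonneg c))

theorem tNorm_smul (h0 : 0 ≤ θ) (h1 : θ ≤ 1) (c : ℝ) (x : ℕ+ →₀ ℝ) :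
    tNorm θ 𝓕 (c • x) = |c| * tNorm θ 𝓕 x := by
  refine le_antisymm (tNorm_smul_le h0 h1 c x) ?_
  by_cases hc : c = 0
  · subst hc
    simpa using tNorm_nonneg (θ := θ) (𝓕 := 𝓕) _
  · have h := tNorm_smul_le (𝓕 := 𝓕) h0 h1 c⁻¹ (c • x)
    rw [smul_smul, inv_mul_cancel₀ hc, one_smul, abs_inv] at h
    calc |c| * tNorm θ 𝓕 x ≤ |c| * (|c|⁻¹ * tNorm θ 𝓕 (c • x)) :=
          mul_le_mul_of_nonneg_left h (abs_nonneg c)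
      _ = tNorm θ 𝓕 (c • x) := by
          rw [← mul_assoc, mul_inv_cancel₀ (abs_ne_zero.mpr hc), one_mul]

theorem eq_zero_of_tNorm_eq_zero (h0 : 0 ≤ θ) (h1 : θ ≤ 1) (x : ℕ+ →₀ ℝ)
    (h : tNorm θ 𝓕 x = 0) : x = 0 := by
  ext i
  have := abs_le_tNorm (𝓕 := 𝓕) h0 h1 x i
  rw [h] at this
  simpa using this

end

/-! ### The spaces -/

/-- The space `c₀₀` of finitely supported real sequences, indexed by the positive integers, to be
equipped with the norm `tNorm θ 𝓕`. -/
def C00 (_θ : Set.Ioo (0 : ℝ) 1) (_𝓕 : Set (Finset ℕ+)) : Type := ℕ+ →₀ ℝ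

instance (θ : Set.Ioo (0 : ℝ) 1) (𝓕 : Set (Finset ℕ+)) : AddCommGroup (C00 θ 𝓕) :=
  inferInstanceAs (AddCommGroup (ℕ+ →₀ ℝ))

instance (θ : Set.Ioo (0 : ℝ) 1) (𝓕 : Set (Finset ℕ+)) : Module ℝ (C00 θ 𝓕) :=
  inferInstanceAs (Module ℝ (ℕ+ →₀ ℝ))

instance (θ : Set.Ioo (0 : ℝ) 1) (𝓕 : Set (Finset ℕ+)) : Norm (C00 θ 𝓕) :=
  ⟨fun x => tNorm θ 𝓕 x⟩

theorem C00.normCore (θ : Set.Ioo (0 : ℝ) 1) (𝓕 : Set (Finset ℕ+)) :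
    NormedSpace.Core ℝ (C00 θ 𝓕) where
  norm_nonneg x := tNorm_nonneg (θ := θ) (𝓕 := 𝓕) x
  norm_smul c x := tNorm_smul θ.2.1.le θ.2.2.le c x
  norm_triangle x y := tNorm_add_le θ.2.1.le θ.2.2.le x y
  norm_eq_zero_iff x := by
    refine ⟨fun h => eq_zero_of_tNorm_eq_zero θ.2.1.le θ.2.2.le x h, ?_⟩
    rintro rfl
    have h := tNorm_smul (𝓕 := 𝓕) θ.2.1.le θ.2.2.le 0 0
    rw [zero_smul, abs_zero, zero_mul] at h
    exact h

instance (θ : Set.Ioo (0 : ℝ) 1) (𝓕 : Set (Finset ℕ+)) : NormedAddCommGroup (C00 θ 𝓕) :=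
  NormedAddCommGroup.ofCore (C00.normCore θ 𝓕)

instance (θ : Set.Ioo (0 : ℝ) 1) (𝓕 : Set (Finset ℕ+)) : NormedSpace ℝ (C00 θ 𝓕) :=
  NormedSpace.ofCore (C00.normCore θ 𝓕)

/-- The real Banach space `T[θ, 𝓕]`: the completion of `c₀₀` in the norm `tNorm θ 𝓕`. -/
abbrev TSpace (θ : Set.Ioo (0 : ℝ) 1) (𝓕 : Set (Finset ℕ+)) : Type :=
  UniformSpace.Completion (C00 θ 𝓕)

/-- The standard unit vector `e_i`, as an element of `c₀₀`. -/
def C00.e (θ : Set.Ioo (0 : ℝ) 1) (𝓕 : Set (Finset ℕ+)) (i : ℕ+) : C00 θ 𝓕 :=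
  (Finsupp.single i 1 : ℕ+ →₀ ℝ)

/-- The standard unit vector `e_i`, as an element of `T[θ, 𝓕]`. -/
def e {θ : Set.Ioo (0 : ℝ) 1} {𝓕 : Set (Finset ℕ+)} (i : ℕ+) : TSpace θ 𝓕 :=
  (C00.e θ 𝓕 i : UniformSpace.Completion (C00 θ 𝓕))

/-- The number `1 / n` as an element of the open unit interval, for `n ≥ 2`. -/
def oneDiv (n : ℕ+) (hn : 2 ≤ n) : Set.Ioo (0 : ℝ) 1 :=
  ⟨1 / (n : ℝ), by
    have h : (2 : ℝ) ≤ ((n : ℕ) : ℝ) := by exact_mod_cast hn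
    constructor
    · positivity
    · rw [div_lt_one (by linarith)]
      linarith⟩

/-- `U e_i = ε_i e_{π(i)}` for `1 ≤ i ≤ n`, and `U e_i = ε_i e_i` for `i ≥ n + 1`. -/
def ActsBy {θ : Set.Ioo (0 : ℝ) 1} {𝓕 : Set (Finset ℕ+)} (n : ℕ+)
    (U : TSpace θ 𝓕 →L[ℝ] TSpace θ 𝓕) (π : Equiv.Perm (Set.Icc 1 n)) (ε : ℕ+ → ℝ) : Prop :=
  (∀ i : Set.Icc 1 n, U (e (i : ℕ+)) = ε i • e (π i : ℕ+)) ∧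
    ∀ i : ℕ+, n + 1 ≤ i → U (e i) = ε i • e i

end Tsirelson

end

/-!
Write `‖·‖` for the norm of `T[1/n, S₁]`. It satisfies the implicit equation
`‖x‖ = max (‖x‖_∞) (sup (1/n) ∑ ‖E_i x‖)`, the supremum being over admissible families
(`sum_tNorm_proj_le`, `tNorm_le_of_forall`).

An admissible family of at most `n` sets gives no more than the largest of the `‖E_i x‖`, and a
family of more than `n` sets starts after `n`. So the space is the `ℓ_∞`-sum of `ℓ_∞^n`, spanned by
`e_1, …, e_n`, and of the closed span of the other unit vectors (`tNorm_le_of_tail`). Since the norm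
depends only on the moduli of the coordinates, the operators in the theorem are isometries.

Conversely, let `U` be a linear isometry. The unit vectors are weakly null
(`exists_forall_abs_single_lt`), because repeated averages have arbitrarily small norm. Hence the
images of far unit vectors are close to successive blocks supported as far out as desired. Put
`N = max i n`. Adding `e_i` to a sum of `N` far unit vectors leaves its norm equal to `N / n`
(`tNorm_sum_single_insert_le`), whereas for `m > N` the set `{m}` and `N` blocks beyond it form an
admissible family, so a nonzero coordinate of `U e_i` at `m` would make the norm of the image
exceed `N / n`. So the matrix of `U` is upper triangular beyond the first `n` coordinates
(`coord_isometry_eq_zero`).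

If `U` is surjective, the same holds for its inverse, and the diagonal entries of `U` and `U⁻¹` at
`k > n` are at most `1` in modulus with product `1`; so they are `±1`. For `i ≤ n` the vector `U e_i`
has norm `1` in `ℓ_∞^n`, so some entry in its column is `±1`. Finally `‖e_i ± e_j‖ ≤ 1` for `i ≠ j`,
so a row with an entry `±1` has no other nonzero entry
(`coord_isometry_eq_zero_of_abs_eq_one`). This makes the matrix a signed permutation that fixes
every index above `n` up to sign.
-/

namespace Tsirelson

/-! ### Admissible families for the Schreier family -/

theorem admissible_schreier {d : ℕ} {E : Fin d → Finset ℕ+} (hne : ∀ i, (E i).Nonempty)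
    (hlt : ∀ i j, i < j → ∀ a ∈ E i, ∀ b ∈ E j, a < b) (hd : ∀ i, ∀ a ∈ E i, d ≤ (a : ℕ)) :
    Admissible schreier E := by
  refine ⟨hne, fun i j hij => hlt i j hij _ (Finset.max'_mem _ _) _ (Finset.min'_mem _ _), ?_⟩
  intro h
  have hmem := Finset.min'_mem _ h
  rw [Finset.mem_image] at hmem
  obtain ⟨i, -, hi⟩ := hmem
  rw [← hi]
  refine le_trans (Finset.card_image_le.trans ?_) (hd i _ (Finset.min'_mem _ (hne i)))
  simp

theorem Admissible.lt {𝓕 : Set (Finset ℕ+)} {d : ℕ} {E : Fin d → Finset ℕ+}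
    (hE : Admissible 𝓕 E) {i j : Fin d} (hij : i < j) {a b : ℕ+} (ha : a ∈ E i) (hb : b ∈ E j) :
    a < b := by
  obtain ⟨h, hlt, -⟩ := hE
  exact ((Finset.le_max' _ _ ha).trans_lt (hlt i j hij)).trans_le (Finset.min'_le _ _ hb)

theorem Admissible.card_le {d : ℕ} {E : Fin d → Finset ℕ+}
    (hE : Admissible schreier E) {i : Fin d} {a : ℕ+} (ha : a ∈ E i) : d ≤ (a : ℕ) := by
  have hlt' : ∀ i j, i < j → ∀ a ∈ E i, ∀ b ∈ E j, a < b := fun i j hij a ha b hb => hE.lt hij ha hb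
  obtain ⟨h, hlt, hs⟩ := hE
  have hinj : Function.Injective fun i => (E i).min' (h i) := by
    refine StrictMono.injective fun i j hij => ?_
    exact hlt' i j hij _ (Finset.min'_mem _ _) _ (Finset.min'_mem _ _)
  have hmem : (E i).min' (h i) ∈ Finset.univ.image fun i => (E i).min' (h i) :=
    Finset.mem_image_of_mem _ (Finset.mem_univ _)
  have h1 := hs ⟨_, hmem⟩
  rw [Finset.card_image_of_injective _ hinj, Finset.card_univ, Fintype.card_fin] at h1
  have h2 := (Finset.min'_le _ _ hmem).trans (Finset.min'_le _ _ ha)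
  exact h1.trans (by exact_mod_cast h2)

/-! ### The implicit equation for the norm -/

section

variable {θ : ℝ} {𝓕 : Set (Finset ℕ+)}

theorem levelNorm_mono_abs (h0 : 0 ≤ θ) (h1 : θ ≤ 1) (k : ℕ) {x y : ℕ+ →₀ ℝ}
    (h : ∀ i, |y i| ≤ |x i|) : levelNorm θ 𝓕 k y ≤ levelNorm θ 𝓕 k x := by
  induction k generalizing x y with
  | zero => exact ciSup_mono (bddAbove_abs x) h
  | succ k ih =>
    refine max_le ((ih h).trans (le_max_left _ _))
      (Real.sSup_le ?_ (levelNorm_nonneg (k + 1) x))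
    rintro r ⟨d, E, hE, rfl⟩
    have hx := (le_csSup (bddAbove_step (𝓕 := 𝓕) h0 h1 k x) ⟨d, E, hE, rfl⟩).trans
      (le_max_right (levelNorm θ 𝓕 k x) _)
    refine le_trans (mul_le_mul_of_nonneg_left (Finset.sum_le_sum fun i _ => ih fun m => ?_) h0) hx
    rw [proj_apply, proj_apply]
    split_ifs
    · exact h m
    · exact le_rfl

theorem tNorm_mono_abs (h0 : 0 ≤ θ) (h1 : θ ≤ 1) {x y : ℕ+ →₀ ℝ}
    (h : ∀ i, |y i| ≤ |x i|) : tNorm θ 𝓕 y ≤ tNorm θ 𝓕 x :=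
  ciSup_mono (bddAbove_levelNorm h0 h1 x) fun k => levelNorm_mono_abs h0 h1 k h

theorem tNorm_proj_le (h0 : 0 ≤ θ) (h1 : θ ≤ 1) (E : Finset ℕ+) (x : ℕ+ →₀ ℝ) :
    tNorm θ 𝓕 (proj E x) ≤ tNorm θ 𝓕 x := by
  refine tNorm_mono_abs h0 h1 fun i => ?_
  rw [proj_apply]
  split_ifs <;> simp

theorem tNorm_le_l1 (h0 : 0 ≤ θ) (h1 : θ ≤ 1) (x : ℕ+ →₀ ℝ) : tNorm θ 𝓕 x ≤ l1 x :=
  ciSup_le fun k => levelNorm_le_l1 h0 h1 k x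

theorem levelNorm_le_tNorm (h0 : 0 ≤ θ) (h1 : θ ≤ 1) (k : ℕ) (x : ℕ+ →₀ ℝ) :
    levelNorm θ 𝓕 k x ≤ tNorm θ 𝓕 x :=
  le_ciSup (bddAbove_levelNorm h0 h1 x) k

theorem tNorm_zero (h0 : 0 ≤ θ) (h1 : θ ≤ 1) : tNorm θ 𝓕 0 = 0 := by
  refine le_antisymm ((tNorm_le_l1 h0 h1 0).trans ?_) (tNorm_nonneg _)
  simp [l1]

theorem sum_tNorm_proj_le (h0 : 0 ≤ θ) (h1 : θ ≤ 1) {d : ℕ} {E : Fin d → Finset ℕ+}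
    (hE : Admissible 𝓕 E) (x : ℕ+ →₀ ℝ) : θ * ∑ i, tNorm θ 𝓕 (proj (E i) x) ≤ tNorm θ 𝓕 x := by
  have hmono : ∀ y : ℕ+ →₀ ℝ, Monotone fun k => levelNorm θ 𝓕 k y := fun y =>
    monotone_nat_of_le_succ fun k => le_max_left _ _
  have ht : Filter.Tendsto (fun k => θ * ∑ i, levelNorm θ 𝓕 k (proj (E i) x)) Filter.atTop
      (nhds (θ * ∑ i, tNorm θ 𝓕 (proj (E i) x))) :=
    (tendsto_finsetSum _ fun i _ =>
      tendsto_atTop_ciSup (hmono _) (bddAbove_levelNorm h0 h1 _)).const_mul θ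
  refine le_of_tendsto' ht fun k => ?_
  exact ((le_csSup (bddAbove_step (𝓕 := 𝓕) h0 h1 k x) ⟨d, E, hE, rfl⟩).trans
      (le_max_right (levelNorm θ 𝓕 k x) _)).trans (levelNorm_le_tNorm h0 h1 (k + 1) x)

/-- Together with `sum_tNorm_proj_le` this is the implicit equation
`‖x‖ = max (‖x‖_∞) (sup θ ∑ ‖E_i x‖)`. -/
theorem tNorm_le_of_forall (h0 : 0 ≤ θ) (h1 : θ ≤ 1) {x : ℕ+ →₀ ℝ} {B : ℝ}
    (hsup : ∀ i, |x i| ≤ B)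
    (hB : ∀ (d : ℕ) (E : Fin d → Finset ℕ+), Admissible 𝓕 E →
      θ * ∑ i, tNorm θ 𝓕 (proj (E i) x) ≤ B) : tNorm θ 𝓕 x ≤ B := by
  have hB0 : 0 ≤ B := (abs_nonneg _).trans (hsup 1)
  refine ciSup_le fun k => ?_
  induction k with
  | zero => exact ciSup_le hsup
  | succ k ih =>
    refine max_le ih (Real.sSup_le ?_ hB0)
    rintro r ⟨d, E, hE, rfl⟩
    exact (mul_le_mul_of_nonneg_left
      (Finset.sum_le_sum fun i _ => levelNorm_le_tNorm h0 h1 k _) h0).trans (hB d E hE)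

theorem tNorm_le_max_l1 (h0 : 0 ≤ θ) (h1 : θ ≤ 1) {x : ℕ+ →₀ ℝ} {B : ℝ}
    (hsup : ∀ i, |x i| ≤ B) (hl1 : θ * l1 x ≤ B) : tNorm θ 𝓕 x ≤ B := by
  refine tNorm_le_of_forall h0 h1 hsup fun d E hE => le_trans ?_ hl1
  refine mul_le_mul_of_nonneg_left ?_ h0
  exact (Finset.sum_le_sum fun i _ => tNorm_le_l1 h0 h1 _).trans (sum_l1_proj_le hE x)

theorem l1_add_le (x y : ℕ+ →₀ ℝ) : l1 (x + y) ≤ l1 x + l1 y := by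
  classical
  rw [l1_eq_sum (Finsupp.support_add (g₁ := x) (g₂ := y)),
    l1_eq_sum (Finset.subset_union_left (s₁ := x.support) (s₂ := y.support)),
    l1_eq_sum (Finset.subset_union_right (s₁ := x.support) (s₂ := y.support)),
    ← Finset.sum_add_distrib]
  exact Finset.sum_le_sum fun i _ => abs_add_le _ _

theorem l1_smul (c : ℝ) (x : ℕ+ →₀ ℝ) : l1 (c • x) = |c| * l1 x := by
  rw [l1_eq_sum (Finsupp.support_smul (b := c) (g := x)), l1, Finset.mul_sum]
  exact Finset.sum_congr rfl fun i _ => by simp [abs_mul]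

theorem l1_single (i : ℕ+) (c : ℝ) : l1 (Finsupp.single i c) = |c| := by
  rw [l1_eq_sum Finsupp.support_single_subset]
  simp

theorem proj_eq_zero {E : Finset ℕ+} {x : ℕ+ →₀ ℝ} (h : ∀ i ∈ E, x i = 0) : proj E x = 0 := by
  ext i
  rw [proj_apply]
  split_ifs with hi
  · exact h i hi
  · rfl

end

/-! ### The unit vector basis is weakly null -/

section

variable {θ : ℝ}

/-- Each further block `y` of norm at most `t` is cut by at most one set `E i` that also meets the
earlier blocks, so `N` successive blocks meet the sets `E i` at most `N + d` times. -/
theorem exists_sum_of_blocks {𝓕 : Set (Finset ℕ+)} (h0 : 0 ≤ θ) (h1 : θ ≤ 1)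
    (φ : (ℕ+ →₀ ℝ) →ₗ[ℝ] ℝ) {δ t : ℝ} (ht : 0 ≤ t)
    (hP : ∀ q : ℕ+, ∃ z : ℕ+ →₀ ℝ, (∀ i ∈ z.support, q < i) ∧ l1 z ≤ 1 ∧ δ ≤ φ z ∧
      tNorm θ 𝓕 z ≤ t) (q : ℕ+) (N : ℕ) :
    ∃ z : ℕ+ →₀ ℝ, (∀ i ∈ z.support, q < i) ∧ l1 z ≤ N ∧ N * δ ≤ φ z ∧
      ∀ (d : ℕ) (E : Fin d → Finset ℕ+), (∀ i j, i < j → ∀ a ∈ E i, ∀ b ∈ E j, a < b) →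
        ∑ i, tNorm θ 𝓕 (proj (E i) z) ≤
          t * (N + (Finset.univ.filter fun i => ∃ m ∈ E i, z m ≠ 0).card) := by
  induction N with
  | zero => 
    refine ⟨0, by simp, by simp [l1], by simp, fun d E hE => ?_⟩
    simp [proj_eq_zero, tNorm_zero h0 h1]
  | succ N ih =>
    obtain ⟨z, hzq, hz1, hzδ, hz⟩ := ih
    obtain ⟨y, hyq, hy1, hyδ, hyt⟩ := hP (q + z.support.sup id)
    have hlt : ∀ a b, z a ≠ 0 → y b ≠ 0 → a < b := by
      intro a b ha hb
      have h2 : a ≤ z.support.sup id :=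
        Finset.le_sup (f := id) (Finsupp.mem_support_iff.mpr ha)
      exact (h2.trans (PNat.lt_add_left _ _).le).trans_lt (hyq b (Finsupp.mem_support_iff.mpr hb))
    have hdisj : ∀ a, z a = 0 ∨ y a = 0 := fun a => by
      by_contra! h
      exact lt_irrefl _ (hlt a a h.1 h.2)
    refine ⟨z + y, fun i hi => ?_, ?_, ?_, fun d E hE => ?_⟩
    · rcases Finset.mem_union.mp (Finsupp.support_add hi) with h | h
      · exact hzq i h
      · exact (PNat.lt_add_right _ _).trans (hyq i h)
    · push_cast
      exact (l1_add_le z y).trans (add_le_add hz1 hy1)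
    · push_cast
      rw [map_add, add_mul, one_mul]
      exact add_le_add hzδ hyδ
    · set A := Finset.univ.filter fun i => ∃ m ∈ E i, z m ≠ 0
      set B := Finset.univ.filter fun i => ∃ m ∈ E i, y m ≠ 0
      have hAB : (Finset.univ.filter fun i => ∃ m ∈ E i, (z + y) m ≠ 0) = A ∪ B := by
        ext i
        have hm : ∀ x : ℕ+ →₀ ℝ, (i ∈ Finset.univ.filter fun i => ∃ m ∈ E i, x m ≠ 0) ↔
            ∃ m ∈ E i, x m ≠ 0 := fun x => by simp
        refine (hm (z + y)).trans (Iff.trans ?_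
          (Finset.mem_union.trans (or_congr (hm z) (hm y))).symm)
        rw [← exists_or]
        simp only [Finsupp.add_apply, ← and_or_left]
        refine exists_congr fun m => and_congr_right fun _ => ?_
        rcases hdisj m with h | h <;> simp [h]
      have hcard : (A ∩ B).card ≤ 1 := by
        rw [Finset.card_le_one]
        have key : ∀ i ∈ A ∩ B, ∀ j ∈ A ∩ B, ¬ i < j := by
          intro i hi j hj hij
          obtain ⟨b, hb, hb'⟩ := (Finset.mem_filter.mp (Finset.mem_inter.mp hi).2).2
          obtain ⟨a, ha, ha'⟩ := (Finset.mem_filter.mp (Finset.mem_inter.mp hj).1).2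
          exact lt_asymm (hE i j hij b hb a ha) (hlt a b ha' hb')
        exact fun i hi j hj => le_antisymm (not_lt.mp (key j hj i hi)) (not_lt.mp (key i hi j hj))
      have hy : ∑ i, tNorm θ 𝓕 (proj (E i) y) ≤ t * B.card := by
        rw [← Finset.sum_subset (Finset.subset_univ B)]
        · rw [mul_comm, ← nsmul_eq_mul]
          exact Finset.sum_le_card_nsmul _ _ _ fun i _ => (tNorm_proj_le h0 h1 _ _).trans hyt
        · intro i _ hi
          rw [proj_eq_zero, tNorm_zero h0 h1]
          intro m hm
          by_contra hne
          exact hi (Finset.mem_filter.mpr ⟨Finset.mem_univ _, m, hm, hne⟩)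
      have hsum : ∑ i, tNorm θ 𝓕 (proj (E i) (z + y)) ≤
          ∑ i, tNorm θ 𝓕 (proj (E i) z) + ∑ i, tNorm θ 𝓕 (proj (E i) y) := by
        rw [← Finset.sum_add_distrib]
        refine Finset.sum_le_sum fun i _ => ?_
        rw [proj_add]
        exact tNorm_add_le h0 h1 _ _
      have hc : ((A.card : ℝ) + B.card) ≤ (A ∪ B).card + 1 := by
        have := Finset.card_union_add_card_inter A B
        exact_mod_cast this.symm.le.trans (Nat.add_le_add_left hcard _)
      have hc' := mul_le_mul_of_nonneg_left hc ht
      rw [hAB]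
      push_cast
      have := hz d E hE
      linarith

/-- A long average of blocks of norm at most `t` cannot be improved much by cutting it into few
pieces. -/
theorem exists_average_of_blocks {𝓕 : Set (Finset ℕ+)} (h0 : 0 ≤ θ) (h1 : θ ≤ 1)
    (φ : (ℕ+ →₀ ℝ) →ₗ[ℝ] ℝ) {δ t ε : ℝ} (ht : 0 ≤ t) (hε : 0 < ε)
    (hP : ∀ q : ℕ+, ∃ z : ℕ+ →₀ ℝ, (∀ i ∈ z.support, q < i) ∧ l1 z ≤ 1 ∧ δ ≤ φ z ∧
      tNorm θ 𝓕 z ≤ t) (q : ℕ+) :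
    ∃ z : ℕ+ →₀ ℝ, (∀ i ∈ z.support, q < i) ∧ l1 z ≤ 1 ∧ δ ≤ φ z ∧
      ∀ (d : ℕ) (E : Fin d → Finset ℕ+), (∀ i j, i < j → ∀ a ∈ E i, ∀ b ∈ E j, a < b) →
        d ≤ (q : ℕ) → ∑ i, tNorm θ 𝓕 (proj (E i) z) ≤ t + ε := by
  obtain ⟨N, hN⟩ := exists_nat_gt (t * (q : ℕ) / ε)
  have hN0 : (0 : ℝ) < N := lt_of_le_of_lt (by positivity) hN
  obtain ⟨z, hzq, hz1, hzδ, hz⟩ := exists_sum_of_blocks h0 h1 φ ht hP q N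
  refine ⟨(N : ℝ)⁻¹ • z, fun i hi => hzq i (Finsupp.support_smul hi), ?_, ?_,
    fun d E hE hd => ?_⟩
  · rw [l1_smul, abs_of_pos (inv_pos.mpr hN0)]
    exact (inv_mul_le_iff₀ hN0).mpr (by linarith)
  · rw [map_smul, smul_eq_mul]
    exact (le_inv_mul_iff₀ hN0).mpr hzδ
  · simp only [proj_smul, tNorm_smul h0 h1, abs_of_pos (inv_pos.mpr hN0)]
    rw [← Finset.mul_sum, inv_mul_le_iff₀ hN0]
    refine (hz d E hE).trans ?_
    have hcard : (Finset.univ.filter fun i => ∃ m ∈ E i, z m ≠ 0).card ≤ (q : ℕ) :=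
      ((Finset.card_filter_le _ _).trans (by simp)).trans hd
    have hcard' : ((Finset.univ.filter fun i => ∃ m ∈ E i, z m ≠ 0).card : ℝ) ≤ (q : ℕ) := by
      exact_mod_cast hcard
    have h2 := mul_le_mul_of_nonneg_left hcard' ht
    rw [div_lt_iff₀ hε] at hN
    linarith

/-- Among successive averages, each flat with respect to the support of the preceding ones, an
admissible family can take advantage only of the first average it meets. -/
theorem exists_sum_of_averages (h0 : 0 ≤ θ) (h1 : θ ≤ 1)
    (φ : (ℕ+ →₀ ℝ) →ₗ[ℝ] ℝ) {δ t : ℝ} (ht : 0 ≤ t)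
    (hP : ∀ q : ℕ+, ∃ z : ℕ+ →₀ ℝ, (∀ i ∈ z.support, q < i) ∧ l1 z ≤ 1 ∧ δ ≤ φ z ∧
      ∀ (d : ℕ) (E : Fin d → Finset ℕ+), (∀ i j, i < j → ∀ a ∈ E i, ∀ b ∈ E j, a < b) →
        d ≤ (q : ℕ) → ∑ i, tNorm θ schreier (proj (E i) z) ≤ t) (q : ℕ+) (M : ℕ) :
    ∃ z : ℕ+ →₀ ℝ, (∀ i ∈ z.support, q < i) ∧ l1 z ≤ M ∧ (∀ i, |z i| ≤ 1) ∧ M * δ ≤ φ z ∧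
      ∀ (d : ℕ) (E : Fin d → Finset ℕ+), Admissible schreier E →
        ∑ i, tNorm θ schreier (proj (E i) z) ≤ 1 + M * t := by
  induction M with
  | zero =>
    refine ⟨0, by simp, by simp [l1], by simp, by simp, fun d E hE => ?_⟩
    simp [proj_eq_zero, tNorm_zero h0 h1]
  | succ M ih =>
    obtain ⟨z, hzq, hz1, hzs, hzδ, hz⟩ := ih
    obtain ⟨y, hyq, hy1, hyδ, hyt⟩ := hP (q + z.support.sup id)
    have hle : ∀ a, z a ≠ 0 → a ≤ q + z.support.sup id := fun a ha =>
      (Finset.le_sup (f := id) (Finsupp.mem_support_iff.mpr ha)).trans (PNat.lt_add_left _ _).le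
    have hy0 : ∀ a, a ≤ q + z.support.sup id → y a = 0 := fun a ha => by
      by_contra h
      exact absurd (hyq a (Finsupp.mem_support_iff.mpr h)) (not_lt.mpr ha)
    refine ⟨z + y, fun i hi => ?_, ?_, fun i => ?_, ?_, fun d E hE => ?_⟩
    · rcases Finset.mem_union.mp (Finsupp.support_add hi) with h | h
      · exact hzq i h
      · exact (PNat.lt_add_right _ _).trans (hyq i h)
    · push_cast
      exact (l1_add_le z y).trans (add_le_add hz1 hy1)
    · rw [Finsupp.add_apply]
      by_cases hzi : z i = 0
      · rw [hzi, zero_add]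
        exact (abs_le_l1 y i).trans hy1
      · rw [hy0 i (hle i hzi), add_zero]
        exact hzs i
    · push_cast
      rw [map_add, add_mul, one_mul]
      exact add_le_add hzδ hyδ
    · simp only [proj_add]
      push_cast
      by_cases hmeet : ∃ i, ∃ a ∈ E i, z a ≠ 0
      · obtain ⟨i, a, ha, haz⟩ := hmeet
        have hd : d ≤ ((q + z.support.sup id : ℕ+) : ℕ) :=
          (hE.card_le ha).trans (by exact_mod_cast hle a haz)
        have h2 := hyt d E (fun i j hij a ha b hb => hE.lt hij ha hb) hd
        have h3 := hz d E hE
        have hsum := Finset.sum_le_sum fun i (_ : i ∈ Finset.univ) =>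
          tNorm_add_le (𝓕 := schreier) h0 h1 (proj (E i) z) (proj (E i) y)
        rw [Finset.sum_add_distrib] at hsum
        linarith
      · push Not at hmeet
        have h2 : ∀ i, proj (E i) z + proj (E i) y = proj (E i) y := fun i => by
          rw [proj_eq_zero (hmeet i), zero_add]
        simp only [h2]
        have h3 : ∑ i, tNorm θ schreier (proj (E i) y) ≤ 1 :=
          ((Finset.sum_le_sum fun i _ => tNorm_le_l1 h0 h1 _).trans (sum_l1_proj_le hE y)).trans hy1
        have : 0 ≤ ((M : ℝ) + 1) * t := by positivity
        linarith

/-- Second order averaging improves the norm by a fixed factor: an average of `M` flat averages of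
blocks of norm at most `t` has norm at most `max (1 / M) (θ (t + t / 4 + 1 / M))`. -/
theorem exists_block_norm_le (h0 : 0 ≤ θ) (h1 : θ ≤ 1 / 2)
    (φ : (ℕ+ →₀ ℝ) →ₗ[ℝ] ℝ) {δ t : ℝ} (ht : 0 < t)
    (hP : ∀ q : ℕ+, ∃ z : ℕ+ →₀ ℝ, (∀ i ∈ z.support, q < i) ∧ l1 z ≤ 1 ∧ δ ≤ φ z ∧
      tNorm θ schreier z ≤ t) (q : ℕ+) :
    ∃ z : ℕ+ →₀ ℝ, (∀ i ∈ z.support, q < i) ∧ l1 z ≤ 1 ∧ δ ≤ φ z ∧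
      tNorm θ schreier z ≤ 3 / 4 * t := by
  have h1' : θ ≤ 1 := by linarith
  -- `1 / M < t / 4`, and `(t + t / 4 + t / 4) / 2 = 3 / 4 * t`
  obtain ⟨M, hM⟩ := exists_nat_gt (4 / t)
  have hM0 : (0 : ℝ) < M := lt_of_le_of_lt (by positivity) hM
  rw [div_lt_iff₀ ht] at hM
  obtain ⟨z, hzq, hz1, hzs, hzδ, hz⟩ := exists_sum_of_averages h0 h1' φ (t := t + t / 4)
    (by positivity) (exists_average_of_blocks h0 h1' φ ht.le (by positivity) hP) q M
  refine ⟨(M : ℝ)⁻¹ • z, fun i hi => hzq i (Finsupp.support_smul hi), ?_, ?_, ?_⟩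
  · rw [l1_smul, abs_of_pos (inv_pos.mpr hM0)]
    exact (inv_mul_le_iff₀ hM0).mpr (by linarith)
  · rw [map_smul, smul_eq_mul]
    exact (le_inv_mul_iff₀ hM0).mpr hzδ
  · rw [tNorm_smul h0 h1', abs_of_pos (inv_pos.mpr hM0), inv_mul_le_iff₀ hM0]
    refine tNorm_le_of_forall h0 h1' (fun i => (hzs i).trans ?_) fun d E hE => ?_
    · linarith
    · have hn : 0 ≤ ∑ i, tNorm θ schreier (proj (E i) z) :=
        Finset.sum_nonneg fun i _ => tNorm_nonneg _
      have h3 := hz d E hE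
      have h4 := mul_le_mul h1 h3 hn (by norm_num)
      linarith

/-- A functional that stays away from zero on infinitely many unit vectors would make them behave
like the basis of `ℓ₁`, whereas repeated averages have arbitrarily small norm. -/
theorem exists_forall_abs_single_lt (h0 : 0 ≤ θ) (h1 : θ ≤ 1 / 2)
    (φ : (ℕ+ →₀ ℝ) →ₗ[ℝ] ℝ) {C : ℝ} (hφ : ∀ x, |φ x| ≤ C * tNorm θ schreier x) {δ : ℝ}
    (hδ : 0 < δ) : ∃ q : ℕ+, ∀ k, q < k → |φ (Finsupp.single k 1)| < δ := by
  by_contra! hcon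
  have key : ∀ (s : ℕ) (q : ℕ+), ∃ z : ℕ+ →₀ ℝ, (∀ i ∈ z.support, q < i) ∧ l1 z ≤ 1 ∧ δ ≤ φ z ∧
      tNorm θ schreier z ≤ (3 / 4 : ℝ) ^ s := by
    intro s
    induction s with
    | zero =>
      intro q
      obtain ⟨k, hk, hkδ⟩ := hcon q
      have hc : ∃ c : ℝ, |c| = 1 ∧ c * φ (Finsupp.single k 1) = |φ (Finsupp.single k 1)| := by
        rcases abs_choice (φ (Finsupp.single k 1)) with h | h
        · exact ⟨1, by simp, by rw [h]; ring⟩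
        · exact ⟨-1, by simp, by rw [h]; ring⟩
      obtain ⟨c, hc1, hc2⟩ := hc
      refine ⟨Finsupp.single k c, fun i hi => ?_, ?_, ?_, ?_⟩
      · rw [Finset.mem_singleton.mp (Finsupp.support_single_subset hi)]
        exact hk
      · rw [l1_single, hc1]
      · rw [← mul_one c, ← smul_eq_mul, ← Finsupp.smul_single, map_smul, smul_eq_mul, hc2]
        exact hkδ
      · refine (tNorm_le_l1 h0 (by linarith) _).trans ?_
        rw [l1_single, hc1, pow_zero]
    | succ s ih =>
      intro q
      rw [pow_succ']
      exact exists_block_norm_le h0 h1 φ (by positivity) ih q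
  have hlim : Filter.Tendsto (fun s : ℕ => C * (3 / 4 : ℝ) ^ s) Filter.atTop (nhds (C * 0)) :=
    (tendsto_pow_atTop_nhds_zero_of_lt_one (by norm_num) (by norm_num)).const_mul C
  rw [mul_zero] at hlim
  have hC : 0 ≤ C := by
    have := hφ (Finsupp.single 1 1)
    have h2 := abs_le_tNorm (𝓕 := schreier) h0 (by linarith) (Finsupp.single 1 1) 1
    rw [Finsupp.single_eq_same, abs_one] at h2
    by_contra! hneg
    nlinarith [abs_nonneg (φ (Finsupp.single 1 1))]
  refine absurd (ge_of_tendsto' hlim (b := δ) fun s => ?_) (not_le.mpr hδ)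
  obtain ⟨z, -, -, hz, hzt⟩ := key s 1
  exact (hz.trans (le_abs_self _)).trans ((hφ z).trans (mul_le_mul_of_nonneg_left hzt hC))

end

/-! ### Norms of sums of unit vectors -/

section

variable {θ : ℝ}

theorem sum_single_apply (F : Finset ℕ+) (a : ℕ+) :
    (∑ k ∈ F, Finsupp.single k (1 : ℝ)) a = if a ∈ F then 1 else 0 := by
  rw [Finsupp.finsetSum_apply]
  simp [Finsupp.single_apply]

theorem l1_proj_sum_single (E F : Finset ℕ+) :
    l1 (proj E (∑ k ∈ F, Finsupp.single k (1 : ℝ))) = (E ∩ F).card := by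
  rw [l1_eq_sum (s := E ∩ F)]
  · rw [Finset.card_eq_sum_ones, Nat.cast_sum]
    refine Finset.sum_congr rfl fun a ha => ?_
    rw [Finset.mem_inter] at ha
    rw [proj_apply, sum_single_apply, if_pos ha.1, if_pos ha.2, abs_one, Nat.cast_one]
  · intro a ha
    rw [Finsupp.mem_support_iff, proj_apply, sum_single_apply] at ha
    by_contra h
    rw [Finset.mem_inter, not_and_or] at h
    rcases h with h | h <;> simp [h] at ha

theorem l1_sum_single (F : Finset ℕ+) : l1 (∑ k ∈ F, Finsupp.single k (1 : ℝ)) = F.card := by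
  have h : proj F (∑ k ∈ F, Finsupp.single k (1 : ℝ)) = ∑ k ∈ F, Finsupp.single k (1 : ℝ) := by
    ext a
    rw [proj_apply, sum_single_apply]
    split_ifs <;> rfl
  rw [← h, l1_proj_sum_single, Finset.inter_self]

/-- Adding `e_i` to a sum of `N ≥ i` later unit vectors does not increase the norm: an admissible
family that reaches back to `i` has at most `N` members, so to cover all `N + 1` unit vectors one
of them has to take at least two, which costs at least `1`. -/
theorem tNorm_sum_single_insert_le {n : ℕ} (hn : 2 ≤ n) (hθ : θ = 1 / n) {i : ℕ+}
    {F : Finset ℕ+} (hiF : i ∉ F) (hF : (i : ℕ) ≤ F.card) (hnF : n ≤ F.card) :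
    tNorm θ schreier (∑ k ∈ insert i F, Finsupp.single k (1 : ℝ)) ≤ F.card / n := by
  have hn' : (2 : ℝ) ≤ n := by exact_mod_cast hn
  have hnpos : (0 : ℝ) < n := by linarith
  have h0 : 0 ≤ θ := by rw [hθ]; positivity
  have h1 : θ ≤ 1 := by
    rw [hθ, div_le_one hnpos]
    linarith
  have hmul : ∀ {S B : ℝ}, S ≤ n * B → θ * S ≤ B := fun {S B} h => by
    rw [hθ, one_div, inv_mul_le_iff₀ hnpos]
    exact h
  refine tNorm_le_of_forall h0 h1 (fun a => ?_) fun d E hE => ?_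
  · have h : (1 : ℝ) ≤ F.card / n := by
      rw [le_div_iff₀ hnpos, one_mul]
      exact_mod_cast hnF
    rw [sum_single_apply]
    split_ifs
    · simpa using h
    · simpa using zero_le_one.trans h
  · refine hmul ?_
    rw [mul_div_cancel₀ _ hnpos.ne']
    by_cases hi : ∃ l, i ∈ E l
    · obtain ⟨l, hl⟩ := hi
      have hd : (d : ℝ) ≤ F.card := by exact_mod_cast (hE.card_le hl).trans hF
      have hc := sum_l1_proj_le hE (∑ k ∈ insert i F, Finsupp.single k (1 : ℝ))
      rw [l1_sum_single, Finset.card_insert_of_notMem hiF] at hc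
      push_cast at hc
      by_cases hall : ∀ l, (E l ∩ insert i F).card ≤ 1
      · refine le_trans (Finset.sum_le_card_nsmul _ _ 1 fun l _ => ?_) (le_trans (by simp) hd)
        refine (tNorm_le_l1 h0 h1 _).trans ?_
        rw [l1_proj_sum_single]
        exact_mod_cast hall l
      · push Not at hall
        obtain ⟨j, hj⟩ := hall
        have hj' : (2 : ℝ) ≤ (E j ∩ insert i F).card := by exact_mod_cast hj
        have hjn : tNorm θ schreier (proj (E j) (∑ k ∈ insert i F, Finsupp.single k (1 : ℝ))) ≤
            l1 (proj (E j) (∑ k ∈ insert i F, Finsupp.single k (1 : ℝ))) - 1 := by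
          rw [l1_proj_sum_single]
          refine tNorm_le_max_l1 h0 h1 (fun a => ?_) ?_
          · rw [proj_apply, sum_single_apply]
            split_ifs
            · rw [abs_one]
              linarith
            · rw [abs_zero]
              linarith
            · rw [abs_zero]
              linarith
          · rw [l1_proj_sum_single]
            refine hmul ?_
            nlinarith
        rw [← Finset.add_sum_erase _ _ (Finset.mem_univ j)] at hc ⊢
        have := Finset.sum_le_sum fun l (_ : l ∈ Finset.univ.erase j) =>
          tNorm_le_l1 (𝓕 := schreier) h0 h1
            (proj (E l) (∑ k ∈ insert i F, Finsupp.single k (1 : ℝ)))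
        linarith
    · push Not at hi
      have hproj : ∀ l, proj (E l) (∑ k ∈ insert i F, Finsupp.single k (1 : ℝ)) =
          proj (E l) (∑ k ∈ F, Finsupp.single k (1 : ℝ)) := fun l => by
        rw [Finset.sum_insert hiF, proj_add, proj_eq_zero, zero_add]
        intro a ha
        rw [Finsupp.single_apply, if_neg]
        rintro rfl
        exact hi l ha
      simp only [hproj]
      refine (Finset.sum_le_sum fun l _ => tNorm_le_l1 h0 h1 _).trans ?_
      refine (sum_l1_proj_le hE _).trans ?_
      rw [l1_sum_single]

/-- An admissible family with at most `n` members is useless when `θ = 1 / n`, and a larger one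
starts after `n`. Hence the span of `e_1, …, e_n` is an `ℓ_∞`-summand. -/
theorem tNorm_le_of_tail {n : ℕ+} (hθ : θ = 1 / (n : ℕ)) {x y : ℕ+ →₀ ℝ}
    {B : ℝ} (hx : ∀ i ≤ n, |x i| ≤ B) (hxy : ∀ i, n < i → |x i| ≤ |y i|)
    (hy : tNorm θ schreier y ≤ B) : tNorm θ schreier x ≤ B := by
  have hn' : (1 : ℝ) ≤ (n : ℕ) := by exact_mod_cast one_le
  have hnpos : (0 : ℝ) < (n : ℕ) := by linarith
  have h0 : 0 ≤ θ := by rw [hθ]; positivity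
  have h1 : θ ≤ 1 := by
    rw [hθ, div_le_one hnpos]
    linarith
  have hB : 0 ≤ B := (abs_nonneg _).trans (hx n le_rfl)
  refine ciSup_le fun k => ?_
  induction k generalizing x with
  | zero =>
    refine ciSup_le fun i => ?_
    rcases le_or_gt i n with hi | hi
    · exact hx i hi
    · exact (hxy i hi).trans ((abs_le_tNorm h0 h1 y i).trans hy)
  | succ k ih =>
    refine max_le (ih hx hxy) (Real.sSup_le ?_ hB)
    rintro r ⟨d, E, hE, rfl⟩
    rcases le_or_gt d (n : ℕ) with hd | hd
    · have hle : ∑ i, levelNorm θ schreier k (proj (E i) x) ≤ d * B := by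
        refine (Finset.sum_le_card_nsmul _ _ B fun i _ => ih (fun a ha => ?_) fun a ha => ?_).trans
          (by simp)
        · rw [proj_apply]
          split_ifs
          · exact hx a ha
          · simpa using hB
        · rw [proj_apply]
          split_ifs
          · exact hxy a ha
          · simp
      have hmul : ∀ {S : ℝ}, S ≤ (n : ℕ) * B → θ * S ≤ B := fun {S} h => by
        rw [hθ, one_div, inv_mul_le_iff₀ hnpos]
        exact h
      refine hmul (hle.trans ?_)
      refine mul_le_mul_of_nonneg_right ?_ hB
      exact_mod_cast hd
    · refine le_trans (mul_le_mul_of_nonneg_left (Finset.sum_le_sum fun i _ => ?_) h0)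
        ((sum_tNorm_proj_le h0 h1 hE y).trans hy)
      refine (levelNorm_le_tNorm h0 h1 k _).trans (tNorm_mono_abs h0 h1 fun a => ?_)
      rw [proj_apply, proj_apply]
      split_ifs with ha
      · exact hxy a (PNat.coe_lt_coe _ _ |>.mp (hd.trans_le (hE.card_le ha)))
      · exact le_rfl

end

/-! ### Coordinates on the completion -/

section

variable {θ : Set.Ioo (0 : ℝ) 1} {𝓕 : Set (Finset ℕ+)}

/-- The inclusion of the finitely supported sequences in `T[θ, 𝓕]`. -/
noncomputable def incl (θ : Set.Ioo (0 : ℝ) 1) (𝓕 : Set (Finset ℕ+)) :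
    (ℕ+ →₀ ℝ) →ₗ[ℝ] TSpace θ 𝓕 :=
  (UniformSpace.Completion.toComplL (𝕜 := ℝ) (E := C00 θ 𝓕)).toLinearMap.comp
    (LinearMap.id : C00 θ 𝓕 →ₗ[ℝ] C00 θ 𝓕)

theorem norm_incl (x : ℕ+ →₀ ℝ) : ‖incl θ 𝓕 x‖ = tNorm θ 𝓕 x :=
  UniformSpace.Completion.norm_coe (E := C00 θ 𝓕) x

theorem denseRange_incl : DenseRange (incl θ 𝓕) :=
  UniformSpace.Completion.denseRange_coe (α := C00 θ 𝓕)

theorem incl_single (i : ℕ+) : incl θ 𝓕 (Finsupp.single i 1) = e i := rfl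

/-- The `m`-th coordinate functional on `T[θ, 𝓕]`. -/
noncomputable def coord (m : ℕ+) : TSpace θ 𝓕 →L[ℝ] ℝ :=
  (Finsupp.lapply m : (ℕ+ →₀ ℝ) →ₗ[ℝ] ℝ).extendOfNorm (incl θ 𝓕)

theorem abs_apply_le_norm_incl (m : ℕ+) (x : ℕ+ →₀ ℝ) :
    ‖(Finsupp.lapply m : (ℕ+ →₀ ℝ) →ₗ[ℝ] ℝ) x‖ ≤ 1 * ‖incl θ 𝓕 x‖ := by
  rw [norm_incl, one_mul]
  exact abs_le_tNorm θ.2.1.le θ.2.2.le x m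

theorem coord_incl (m : ℕ+) (x : ℕ+ →₀ ℝ) : coord m (incl θ 𝓕 x) = x m :=
  LinearMap.extendOfNorm_eq denseRange_incl ⟨1, abs_apply_le_norm_incl m⟩ x

theorem abs_coord_le (m : ℕ+) (x : TSpace θ 𝓕) : |coord m x| ≤ ‖x‖ := by
  have := LinearMap.norm_extendOfNorm_apply_le denseRange_incl 1 (abs_apply_le_norm_incl m) x
  rwa [one_mul] at this

theorem coord_e (m i : ℕ+) : coord m (e i : TSpace θ 𝓕) = if i = m then 1 else 0 := by
  rw [← incl_single, coord_incl, Finsupp.single_apply]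

theorem exists_norm_sub_incl_lt (x : TSpace θ 𝓕) {ε : ℝ} (hε : 0 < ε) :
    ∃ x₀ : ℕ+ →₀ ℝ, ‖x - incl θ 𝓕 x₀‖ < ε := by
  obtain ⟨x₀, h⟩ := Metric.denseRange_iff.mp (denseRange_incl (θ := θ) (𝓕 := 𝓕)) x ε hε
  exact ⟨x₀, by rwa [← dist_eq_norm]⟩

theorem incl_proj (S : Finset ℕ+) (x : ℕ+ →₀ ℝ) :
    incl θ 𝓕 (proj S x) = ∑ m ∈ S, coord m (incl θ 𝓕 x) • e m := by
  have h : proj S x = ∑ m ∈ S, x m • Finsupp.single m 1 := by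
    ext a
    rw [proj_apply, Finsupp.finsetSum_apply]
    simp [Finsupp.single_apply]
  rw [h, map_sum]
  exact Finset.sum_congr rfl fun m _ => by rw [map_smul, incl_single, coord_incl]

theorem norm_sum_coord_le (S : Finset ℕ+) (x : TSpace θ 𝓕) :
    ‖∑ m ∈ S, coord m x • (e m : TSpace θ 𝓕)‖ ≤ ‖x‖ := by
  refine denseRange_incl.induction_on x (isClosed_le (by fun_prop) (by fun_prop)) fun x₀ => ?_
  rw [← incl_proj, norm_incl, norm_incl]
  exact tNorm_proj_le θ.2.1.le θ.2.2.le S x₀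

/-- The coordinate projections are contractive, so the coordinates separate the points. -/
theorem eq_zero_of_coord_eq_zero {x : TSpace θ 𝓕} (h : ∀ m, coord m x = 0) : x = 0 := by
  rw [← norm_le_zero_iff]
  refine le_of_forall_pos_le_add fun ε hε => ?_
  obtain ⟨x₀, hx₀⟩ := exists_norm_sub_incl_lt x (half_pos hε)
  have h1 := norm_sum_coord_le x₀.support (x - incl θ 𝓕 x₀)
  have h2 : ∑ m ∈ x₀.support, coord m (x - incl θ 𝓕 x₀) • (e m : TSpace θ 𝓕) =
      -incl θ 𝓕 x₀ := by
    have h3 : proj x₀.support x₀ = x₀ := by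
      ext a
      rw [proj_apply]
      split_ifs with ha
      · rfl
      · exact (Finsupp.notMem_support_iff.mp ha).symm
    conv_rhs => rw [← h3, incl_proj, ← Finset.sum_neg_distrib]
    refine Finset.sum_congr rfl fun m _ => ?_
    rw [map_sub, h m, zero_sub, neg_smul]
  rw [h2, norm_neg] at h1
  have h4 := norm_add_le (x - incl θ 𝓕 x₀) (incl θ 𝓕 x₀)
  rw [sub_add_cancel] at h4
  linarith

theorem ext_coord {x y : TSpace θ 𝓕} (h : ∀ m, coord m x = coord m y) : x = y :=
  sub_eq_zero.mp (eq_zero_of_coord_eq_zero fun m => by rw [map_sub, h m, sub_self])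

theorem eq_sum_coord {x : TSpace θ 𝓕} (S : Finset ℕ+) (h : ∀ m ∉ S, coord m x = 0) :
    x = ∑ m ∈ S, coord m x • (e m : TSpace θ 𝓕) := by
  refine ext_coord fun a => ?_
  rw [map_sum]
  simp only [map_smul, coord_e, smul_eq_mul, mul_ite, mul_one, mul_zero]
  rw [Finset.sum_ite_eq' S a]
  split_ifs with ha
  · rfl
  · exact h a ha

theorem eq_smul_e {x : TSpace θ 𝓕} (i : ℕ+) (h : ∀ m, m ≠ i → coord m x = 0) :
    x = coord i x • (e i : TSpace θ 𝓕) := by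
  simpa using eq_sum_coord {i} fun m hm => h m (by simpa using hm)

end

/-! ### Signed permutations are isometries -/

section

/-- The operator `e_i ↦ ε_i e_{σ(i)}` on finitely supported sequences. -/
noncomputable def signedPerm (σ : Equiv.Perm ℕ+) (ε : ℕ+ → ℝ) (hε : ∀ i, ε i = 1 ∨ ε i = -1) :
    (ℕ+ →₀ ℝ) ≃ₗ[ℝ] (ℕ+ →₀ ℝ) :=
  LinearEquiv.ofLinearMap
    (Finsupp.linearCombination ℝ fun i => Finsupp.single (σ i) (ε i))
    (Finsupp.linearCombination ℝ fun i => Finsupp.single (σ.symm i) (ε (σ.symm i)))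
    (by
      ext i : 2
      rcases hε (σ.symm i) with h | h <;> simp [h])
    (by
      ext i : 2
      rcases hε i with h | h <;> simp [h])

theorem signedPerm_single (σ : Equiv.Perm ℕ+) (ε : ℕ+ → ℝ) (hε : ∀ i, ε i = 1 ∨ ε i = -1)
    (i : ℕ+) : signedPerm σ ε hε (Finsupp.single i 1) = ε i • Finsupp.single (σ i) 1 := by
  simp [signedPerm]

theorem signedPerm_apply (σ : Equiv.Perm ℕ+) (ε : ℕ+ → ℝ) (hε : ∀ i, ε i = 1 ∨ ε i = -1)
    (x : ℕ+ →₀ ℝ) (i : ℕ+) : signedPerm σ ε hε x (σ i) = ε i * x i := by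
  induction x using Finsupp.induction_linear with
  | zero => simp
  | add x y hx hy => rw [map_add, Finsupp.add_apply, hx, hy, Finsupp.add_apply, mul_add]
  | single j c =>
    simp only [signedPerm, LinearEquiv.coe_ofLinearMap, Finsupp.linearCombination_single]
    rcases eq_or_ne j i with rfl | h
    · simp [mul_comm]
    · simp [h]

theorem signedPerm_symm (σ : Equiv.Perm ℕ+) (ε : ℕ+ → ℝ) (hε : ∀ i, ε i = 1 ∨ ε i = -1) :
    (signedPerm σ ε hε).symm = signedPerm σ.symm (ε ∘ σ.symm) (fun _ => hε _) := by
  ext i : 1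
  rfl

theorem tNorm_signedPerm_le {θ : ℝ} {n : ℕ+} (hθ : θ = 1 / (n : ℕ)) {σ : Equiv.Perm ℕ+}
    (hσ : ∀ i, n < i → σ i = i) (ε : ℕ+ → ℝ) (hε : ∀ i, ε i = 1 ∨ ε i = -1) (x : ℕ+ →₀ ℝ) :
    tNorm θ schreier (signedPerm σ ε hε x) ≤ tNorm θ schreier x := by
  have hn' : (1 : ℝ) ≤ (n : ℕ) := by exact_mod_cast one_le
  have h0 : 0 ≤ θ := by rw [hθ]; positivity
  have h1 : θ ≤ 1 := by
    rw [hθ, div_le_one (by linarith)]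
    linarith
  have habs : ∀ i, |signedPerm σ ε hε x (σ i)| = |x i| := fun i => by
    rw [signedPerm_apply, abs_mul]
    rcases hε i with h | h <;> simp [h]
  refine tNorm_le_of_tail hθ (y := x) (fun i _ => ?_) (fun i hi => ?_) le_rfl
  · rw [← σ.apply_symm_apply i, habs]
    exact abs_le_tNorm h0 h1 x _
  · have := habs i
    rw [hσ i hi] at this
    exact this.le

theorem tNorm_signedPerm {θ : ℝ} {n : ℕ+} (hθ : θ = 1 / (n : ℕ)) {σ : Equiv.Perm ℕ+}
    (hσ : ∀ i, n < i → σ i = i) (ε : ℕ+ → ℝ) (hε : ∀ i, ε i = 1 ∨ ε i = -1) (x : ℕ+ →₀ ℝ) :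
    tNorm θ schreier (signedPerm σ ε hε x) = tNorm θ schreier x := by
  refine le_antisymm (tNorm_signedPerm_le hθ hσ ε hε x) ?_
  have h := tNorm_signedPerm_le hθ (σ := σ.symm)
    (fun i hi => by rw [Equiv.symm_apply_eq, hσ i hi]) (ε ∘ σ.symm) (fun i => hε _)
    (signedPerm σ ε hε x)
  rwa [← signedPerm_symm σ ε hε, LinearEquiv.symm_apply_apply] at h

variable {n : ℕ+} {hn : 2 ≤ n}

/-- The surjective isometry of `T[1/n, S₁]` given by a permutation of the first `n` unit vectors
and a choice of signs. -/
theorem exists_linearIsometryEquiv (π : Equiv.Perm (Set.Icc 1 n)) (ε : ℕ+ → ℝ)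
    (hε : ∀ i, ε i = 1 ∨ ε i = -1) :
    ∃ V : TSpace (oneDiv n hn) schreier ≃ₗᵢ[ℝ] TSpace (oneDiv n hn) schreier,
      (∀ i : Set.Icc 1 n, V (e (i : ℕ+)) = ε i • e (π i : ℕ+)) ∧
        ∀ i : ℕ+, n + 1 ≤ i → V (e i) = ε i • e i := by
  classical
  have hσ : ∀ i, n < i → Equiv.Perm.ofSubtype π i = i := fun i hi =>
    Equiv.Perm.ofSubtype_apply_of_not_mem π fun h => not_lt.mpr h.2 hi
  refine ⟨(signedPerm (Equiv.Perm.ofSubtype π) ε hε).extendOfIsometry (incl _ _) (incl _ _)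
    denseRange_incl denseRange_incl (fun x => ?_), fun i => ?_, fun i hi => ?_⟩
  · rw [norm_incl, norm_incl]
    exact tNorm_signedPerm rfl hσ ε hε x
  · rw [← incl_single, LinearEquiv.extendOfIsometry_eq, signedPerm_single, map_smul, incl_single,
      Equiv.Perm.ofSubtype_apply_coe]
  · rw [← incl_single, LinearEquiv.extendOfIsometry_eq, signedPerm_single, map_smul,
      hσ i (PNat.add_one_le_iff.mp hi)]

theorem eq_of_forall_e {θ : Set.Ioo (0 : ℝ) 1} {𝓕 : Set (Finset ℕ+)}
    {U V : TSpace θ 𝓕 →L[ℝ] TSpace θ 𝓕} (h : ∀ i, U (e i) = V (e i)) : U = V := by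
  have hlin : U.toLinearMap.comp (incl θ 𝓕) = V.toLinearMap.comp (incl θ 𝓕) := by
    ext i : 2
    simpa using! h i
  refine ContinuousLinearMap.coeFn_injective (denseRange_incl.equalizer U.continuous V.continuous ?_)
  ext x
  exact LinearMap.congr_fun hlin x

theorem ActsBy.exists_linearIsometryEquiv
    {U : TSpace (oneDiv n hn) schreier →L[ℝ] TSpace (oneDiv n hn) schreier}
    {π : Equiv.Perm (Set.Icc 1 n)} {ε : ℕ+ → ℝ} (hε : ∀ i, ε i = 1 ∨ ε i = -1)
    (hU : ActsBy n U π ε) :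
    ∃ V : TSpace (oneDiv n hn) schreier ≃ₗᵢ[ℝ] TSpace (oneDiv n hn) schreier, ⇑U = V := by
  obtain ⟨V, hV1, hV2⟩ := Tsirelson.exists_linearIsometryEquiv (hn := hn) π ε hε
  refine ⟨V, ?_⟩
  have : U = (V : TSpace (oneDiv n hn) schreier →L[ℝ] TSpace (oneDiv n hn) schreier) := by
    refine eq_of_forall_e fun i => ?_
    rcases le_or_gt i n with hi | hi
    · exact (hU.1 ⟨i, one_le, hi⟩).trans (hV1 ⟨i, one_le, hi⟩).symm
    · exact (hU.2 i (PNat.add_one_le_iff.mpr hi)).trans (hV2 i (PNat.add_one_le_iff.mpr hi)).symm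
  rw [this]
  rfl

end

/-! ### Surjective isometries are signed permutations -/

section

variable {n : ℕ+} {hn : 2 ≤ n}

theorem oneDiv_le_half : ((oneDiv n hn : Set.Ioo (0 : ℝ) 1) : ℝ) ≤ 1 / 2 := by
  have h : (2 : ℝ) ≤ ((n : ℕ) : ℝ) := by exact_mod_cast hn
  exact one_div_le_one_div_of_le (by norm_num) h

theorem norm_e {θ : Set.Ioo (0 : ℝ) 1} {𝓕 : Set (Finset ℕ+)} (i : ℕ+) :
    ‖(e i : TSpace θ 𝓕)‖ = 1 := by
  rw [← incl_single, norm_incl]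
  refine le_antisymm ((tNorm_le_l1 θ.2.1.le θ.2.2.le _).trans ?_) ?_
  · rw [l1_single, abs_one]
  · simpa using abs_le_tNorm (𝓕 := 𝓕) θ.2.1.le θ.2.2.le (Finsupp.single i 1) i

theorem eventually_abs_lt (f : TSpace (oneDiv n hn) schreier →L[ℝ] ℝ) {δ : ℝ} (hδ : 0 < δ) :
    ∀ᶠ k in Filter.atTop, |f (e k)| < δ := by
  obtain ⟨q, hq⟩ := exists_forall_abs_single_lt (oneDiv n hn).2.1.le oneDiv_le_half
    (f.toLinearMap.comp (incl (oneDiv n hn) schreier)) (C := ‖f‖)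
    (fun x => by rw [← norm_incl]; exact f.le_opNorm _) hδ
  filter_upwards [Filter.eventually_gt_atTop q] with k hk
  exact hq k hk

/-- The images of the unit vectors under a bounded operator are weakly null, so far out they are
nearly supported beyond any given coordinate. -/
theorem exists_block_near
    (U : TSpace (oneDiv n hn) schreier →L[ℝ] TSpace (oneDiv n hn) schreier) {ε : ℝ} (hε : 0 < ε)
    (M : ℕ+) : ∃ k, M < k ∧ ∃ y : ℕ+ →₀ ℝ, (∀ a ∈ y.support, M < a) ∧
      ‖U (e k) - incl (oneDiv n hn) schreier y‖ < ε := by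
  have h0 := (oneDiv n hn).2.1.le
  have h1 := (oneDiv n hn).2.2.le
  set S := Finset.Icc 1 M
  set η := ε / (2 * S.card + 1) with hη
  have hη0 : 0 < η := by positivity
  have hev : ∀ᶠ k in Filter.atTop, ∀ m ∈ S,
      |coord m (U (e k : TSpace (oneDiv n hn) schreier))| < η :=
    (Filter.eventually_all_finset S).mpr fun m _ => eventually_abs_lt ((coord m).comp U) hη0
  obtain ⟨k, hkM, hk⟩ := ((Filter.eventually_gt_atTop M).and hev).exists
  obtain ⟨y, hy⟩ := exists_norm_sub_incl_lt (U (e k)) hη0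
  refine ⟨k, hkM, y - proj S y, fun a ha => ?_, ?_⟩
  · by_contra! hle
    rw [Finsupp.mem_support_iff, Finsupp.sub_apply, proj_apply,
      if_pos (Finset.mem_Icc.mpr ⟨one_le, hle⟩), sub_self] at ha
    exact ha rfl
  · have hproj : ‖incl (oneDiv n hn) schreier (proj S y)‖ ≤ S.card * (2 * η) := by
      rw [norm_incl]
      refine (tNorm_le_l1 h0 h1 _).trans ?_
      rw [l1_eq_sum (s := S)]
      · refine (Finset.sum_le_card_nsmul _ _ (2 * η) fun m hm => ?_).trans (by simp)
        rw [proj_apply, if_pos hm]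
        have h2 := abs_coord_le m (U (e k) - incl (oneDiv n hn) schreier y)
        rw [map_sub, coord_incl] at h2
        have h3 := hk m hm
        rw [abs_lt] at h3
        rw [abs_le] at h2
        rw [abs_le]
        constructor <;> linarith
      · intro a ha
        by_contra h
        rw [Finsupp.mem_support_iff, proj_apply, if_neg h] at ha
        exact ha rfl
    have h4 : U (e k) - incl (oneDiv n hn) schreier (y - proj S y) =
        (U (e k) - incl (oneDiv n hn) schreier y) + incl (oneDiv n hn) schreier (proj S y) := by
      rw [map_sub]
      abel
    have h5 : η * (2 * S.card + 1) = ε := div_mul_cancel₀ _ (by positivity)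
    rw [h4]
    refine (norm_add_le _ _).trans_lt ?_
    linarith

theorem exists_block_sequence
    (U : TSpace (oneDiv n hn) schreier →L[ℝ] TSpace (oneDiv n hn) schreier) {ε : ℝ} (hε : 0 < ε)
    (M₀ : ℕ+) : ∃ (k : ℕ → ℕ+) (y : ℕ → ℕ+ →₀ ℝ), StrictMono k ∧ (∀ j, M₀ < k j) ∧
      (∀ j, ∀ a ∈ (y j).support, M₀ < a) ∧
      (∀ i j, i < j → ∀ a ∈ (y i).support, ∀ b ∈ (y j).support, a < b) ∧
      ∀ j, ‖U (e (k j)) - incl (oneDiv n hn) schreier (y j)‖ < ε := by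
  choose k hk y hy hU using exists_block_near U hε
  -- `M j` is the bound beyond which the `j`-th index and block are chosen
  let M : ℕ → ℕ+ := fun j => Nat.rec M₀ (fun _ M => M + k M + (y M).support.sup id) j
  have hM : ∀ j, M (j + 1) = M j + k (M j) + (y (M j)).support.sup id := fun j => rfl
  have hmono : StrictMono M := strictMono_nat_of_lt_succ fun j => by
    rw [hM]
    exact (PNat.lt_add_right _ _).trans (PNat.lt_add_right _ _)
  have hM₀ : ∀ j, M₀ ≤ M j := fun j => hmono.monotone (Nat.zero_le j)
  refine ⟨fun j => k (M j), fun j => y (M j), strictMono_nat_of_lt_succ fun j => ?_,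
    fun j => (hM₀ j).trans_lt (hk _), fun j a ha => (hM₀ j).trans_lt (hy _ a ha),
    fun i j hij a ha b hb => ?_, fun j => hU _⟩
  · refine lt_trans ?_ (hk (M (j + 1)))
    rw [hM]
    exact (PNat.lt_add_left _ _).trans (PNat.lt_add_right _ _)
  · refine lt_of_le_of_lt ?_ (hy _ b hb)
    refine le_trans ?_ (hmono.monotone (Nat.succ_le_of_lt hij))
    rw [Nat.succ_eq_add_one, hM]
    exact (Finset.le_sup (f := id) ha).trans (PNat.lt_add_left _ _).le

/-- Linear isometries are upper triangular beyond the first `n` coordinates: with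
`N = max i n`, the vector `e_i` does not increase the norm of a sum of `N` far unit vectors, while
a nonzero coordinate of `U e_i` at `m > N` would increase the norm of the sum of their images,
because `{m}` together with the supports of these images is an admissible family. -/
theorem coord_isometry_eq_zero
    (U : TSpace (oneDiv n hn) schreier →ₗᵢ[ℝ] TSpace (oneDiv n hn) schreier) {i m : ℕ+}
    (hnm : n < m) (him : i < m) : coord m (U (e i)) = 0 := by
  have h0 := (oneDiv n hn).2.1.le
  have h1 := (oneDiv n hn).2.2.le
  have hn' : (0 : ℝ) < (n : ℕ) := by exact_mod_cast n.pos
  by_contra hne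
  set c := |coord m (U (e i))| with hc
  have hc0 : 0 < c := abs_pos.mpr hne
  obtain ⟨N, hN⟩ : ∃ N : ℕ, N = max (i : ℕ) (n : ℕ) := ⟨_, rfl⟩
  have hiN : (i : ℕ) ≤ N := hN ▸ le_max_left _ _
  have hnN : (n : ℕ) ≤ N := hN ▸ le_max_right _ _
  have hNm : N + 1 ≤ (m : ℕ) := by
    rw [hN]
    exact Nat.succ_le_of_lt (max_lt (by exact_mod_cast him) (by exact_mod_cast hnm))
  -- with approximations of accuracy `ε` the estimates below give `c ≤ D * ε`
  set D : ℝ := 1 + N + (n : ℕ) * (N + 1) with hD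
  have hD0 : 0 < D := by positivity
  set ε := min (1 / 2) (c / (2 * D)) with hεdef
  have hε : 0 < ε := lt_min (by norm_num) (by positivity)
  have hε1 : ε ≤ 1 / 2 := min_le_left _ _
  have hεc : ε * (2 * D) ≤ c := by
    rw [← le_div_iff₀ (by positivity)]
    exact min_le_right _ _
  obtain ⟨x, hx⟩ := exists_norm_sub_incl_lt (U (e i)) hε
  obtain ⟨k, y, hkmono, hkM, hyM, hylt, hUy⟩ :=
    exists_block_sequence U.toContinuousLinearMap hε (m + i + x.support.sup id)
  have hUy' : ∀ j, ‖U (e (k j)) - incl (oneDiv n hn) schreier (y j)‖ < ε := hUy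
  have hmM : m < m + i + x.support.sup id :=
    (PNat.lt_add_right _ _).trans (PNat.lt_add_right _ _)
  have hxM : ∀ a ∈ x.support, a < m + i + x.support.sup id := fun a ha =>
    (Finset.le_sup (f := id) ha).trans_lt (PNat.lt_add_left _ _)
  -- the upper estimate, on the domain side
  set F := (Finset.range N).image k with hF
  have hFcard : F.card = N := by
    rw [hF, Finset.card_image_of_injective _ hkmono.injective, Finset.card_range]
  have hiF : i ∉ F := by
    intro h
    obtain ⟨j, -, hj⟩ := Finset.mem_image.mp h
    have h2 := hkM j
    rw [hj] at h2
    exact lt_asymm h2 ((PNat.lt_add_left _ _).trans (PNat.lt_add_right _ _))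
  have hupper : ‖U (e i) + ∑ j ∈ Finset.range N, U (e (k j))‖ ≤ N / (n : ℕ) := by
    have h := tNorm_sum_single_insert_le (θ := (oneDiv n hn : ℝ)) (n := (n : ℕ))
      (by exact_mod_cast hn) rfl hiF (by rwa [hFcard]) (by rwa [hFcard])
    rw [← norm_incl, map_sum, Finset.sum_insert hiF, hF,
      Finset.sum_image hkmono.injective.injOn, ← hF, hFcard] at h
    simp only [incl_single] at h
    rwa [← map_sum, ← map_add, U.norm_map]
  -- the lower estimate, for finitely supported approximations of the images
  set X := x + ∑ j ∈ Finset.range N, y j with hX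
  have hXnorm : tNorm (oneDiv n hn : ℝ) schreier X ≤ N / (n : ℕ) + (N + 1) * ε := by
    rw [← norm_incl]
    have hdiff : ‖(U (e i) + ∑ j ∈ Finset.range N, U (e (k j))) - incl (oneDiv n hn) schreier X‖ ≤
        (N + 1) * ε := by
      have h2 : (U (e i) + ∑ j ∈ Finset.range N, U (e (k j))) - incl (oneDiv n hn) schreier X =
          (U (e i) - incl (oneDiv n hn) schreier x) +
            ∑ j ∈ Finset.range N, (U (e (k j)) - incl (oneDiv n hn) schreier (y j)) := by
        rw [hX, map_add, map_sum, Finset.sum_sub_distrib]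
        abel
      rw [h2]
      refine (norm_add_le _ _).trans ?_
      have h3 : ‖∑ j ∈ Finset.range N, (U (e (k j)) - incl (oneDiv n hn) schreier (y j))‖ ≤
          N * ε := by
        refine (norm_sum_le_of_le _ fun j _ => (hUy' j).le).trans ?_
        simp
      linarith
    have h4 := norm_sub_norm_le (incl (oneDiv n hn) schreier X)
      (U (e i) + ∑ j ∈ Finset.range N, U (e (k j)))
    rw [norm_sub_rev] at h4
    linarith
  have hynorm : ∀ j, 1 - ε ≤ tNorm (oneDiv n hn : ℝ) schreier (y j) := fun j => by
    have h2 := norm_sub_norm_le (U (e (k j))) (incl (oneDiv n hn) schreier (y j))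
    rw [U.norm_map, norm_e, norm_incl] at h2
    linarith [hUy' j]
  have hyne : ∀ j, (y j).support.Nonempty := fun j => by
    rw [Finset.nonempty_iff_ne_empty]
    intro h
    have h2 := hynorm j
    rw [Finsupp.support_eq_empty.mp h, tNorm_zero h0 h1] at h2
    linarith
  let E : Fin (N + 1) → Finset ℕ+ := Fin.cons {m} fun j : Fin N => (y j).support
  have hE : Admissible schreier E := by
    refine admissible_schreier (fun l => ?_) (fun l l' hll => ?_) fun l => ?_
    · refine Fin.cases ?_ (fun j => ?_) l
      · exact Finset.singleton_nonempty m
      · exact hyne j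
    · revert hll
      refine Fin.cases ?_ (fun j' => ?_) l'
      · exact fun h => absurd h (Fin.not_lt_zero l)
      · refine Fin.cases ?_ (fun j => ?_) l
        · intro _ a ha b hb
          rw [Finset.mem_singleton.mp ha]
          exact hmM.trans (hyM j' b hb)
        · intro h
          exact hylt j j' (by exact_mod_cast Fin.succ_lt_succ_iff.mp h)
    · refine Fin.cases ?_ (fun j => ?_) l
      · intro a ha
        rw [Finset.mem_singleton.mp ha]
        exact hNm
      · intro a ha
        exact hNm.trans (by exact_mod_cast (hmM.trans (hyM j a ha)).le)
  have hlower := sum_tNorm_proj_le h0 h1 hE X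
  rw [Fin.sum_univ_succ] at hlower
  have hE0 : |x m| ≤ tNorm (oneDiv n hn : ℝ) schreier (proj (E 0) X) := by
    have h2 := abs_le_tNorm (𝓕 := schreier) h0 h1 (proj (E 0) X) m
    have h3 : proj (E 0) X m = x m := by
      rw [proj_apply, if_pos (show m ∈ E 0 from Finset.mem_singleton_self m), hX, Finsupp.add_apply,
        Finsupp.finsetSum_apply, Finset.sum_eq_zero, add_zero]
      intro j _
      by_contra h
      exact lt_asymm hmM (hyM j m (Finsupp.mem_support_iff.mpr h))
    rwa [h3] at h2
  have hEsucc : ∀ j : Fin N, proj (E j.succ) X = y j := fun j => by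
    have hEj : E j.succ = (y j).support := rfl
    ext a
    rw [proj_apply, hEj]
    split_ifs with ha
    · rw [hX, Finsupp.add_apply, Finsupp.finsetSum_apply, Finset.sum_eq_single (j : ℕ)]
      · have : x a = 0 := by
          by_contra h
          exact lt_asymm (hxM a (Finsupp.mem_support_iff.mpr h)) (hyM j a ha)
        rw [this, zero_add]
      · intro j' _ hj'
        by_contra h
        have h' := Finsupp.mem_support_iff.mpr h
        rcases lt_or_gt_of_ne hj' with hlt | hlt
        · exact lt_irrefl _ (hylt _ _ hlt a h' a ha)
        · exact lt_irrefl _ (hylt _ _ hlt a ha a h')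
      · intro h
        exact absurd (Finset.mem_range.mpr j.2) h
    · exact (Finsupp.notMem_support_iff.mp ha).symm
  have hsum : (N : ℝ) * (1 - ε) ≤
      ∑ j : Fin N, tNorm (oneDiv n hn : ℝ) schreier (proj (E j.succ) X) := by
    simp only [hEsucc]
    refine le_trans (by simp) (Finset.card_nsmul_le_sum _ _ (1 - ε) fun j _ => hynorm j)
  have hθ : ((oneDiv n hn : Set.Ioo (0 : ℝ) 1) : ℝ) = ((n : ℕ) : ℝ)⁻¹ := one_div _
  have hfin : |x m| + N * (1 - ε) ≤ N + (n : ℕ) * ((N + 1) * ε) := by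
    have h2 := (mul_le_mul_of_nonneg_left (add_le_add hE0 hsum) h0).trans (hlower.trans hXnorm)
    have h3 := mul_le_mul_of_nonneg_left h2 hn'.le
    rw [hθ, mul_inv_cancel_left₀ hn'.ne', mul_add, mul_div_cancel₀ _ hn'.ne'] at h3
    exact h3
  have hcx : c ≤ |x m| + ε := by
    have h2 := (abs_coord_le m (U (e i) - incl (oneDiv n hn) schreier x)).trans hx.le
    rw [map_sub, coord_incl] at h2
    have h3 := abs_sub_abs_le_abs_sub (coord m (U (e i))) (x m)
    linarith
  have : c ≤ ε * D := by
    rw [hD]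
    linarith
  linarith

/-- The matrices of an isometry and of its inverse are both upper triangular at `k > n`, so their
diagonal entries, which are at most `1` in modulus, have product `1`. -/
theorem abs_coord_isometry_diag
    (V : TSpace (oneDiv n hn) schreier ≃ₗᵢ[ℝ] TSpace (oneDiv n hn) schreier) {k : ℕ+}
    (hk : n < k) : |coord k (V (e k))| = 1 := by
  have hle : ∀ W : TSpace (oneDiv n hn) schreier ≃ₗᵢ[ℝ] TSpace (oneDiv n hn) schreier,
      |coord k (W (e k))| ≤ 1 := fun W => by
    simpa [norm_e] using abs_coord_le k (W (e k))
  have hsum := eq_sum_coord (x := V (e k)) (Finset.Icc 1 k) fun m hm => by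
    have hkm : k < m := by
      by_contra! h
      exact hm (Finset.mem_Icc.mpr ⟨one_le, h⟩)
    exact coord_isometry_eq_zero V.toLinearIsometry (hk.trans hkm) hkm
  have h := congrArg (fun x => coord k (V.symm x)) hsum
  simp only [V.symm_apply_apply, map_sum, map_smul, smul_eq_mul, coord_e, if_true] at h
  rw [Finset.sum_eq_single k] at h
  · have habs := congrArg abs h
    rw [abs_one, abs_mul] at habs
    nlinarith [hle V, hle V.symm, abs_nonneg (coord k (V (e k))),
      abs_nonneg (coord k (V.symm (e k)))]
  · intro m hm hmk
    have hlt := lt_of_le_of_ne (Finset.mem_Icc.mp hm).2 hmk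
    rw [show coord k (V.symm (e m)) = 0 from
      coord_isometry_eq_zero V.symm.toLinearIsometry hk hlt, mul_zero]
  · exact fun h' => absurd (Finset.mem_Icc.mpr ⟨one_le, le_rfl⟩) h'

/-- The span of `e_1, …, e_n` is isometric to `ℓ_∞^n`, so the norm of `U e_i`, which lies there,
is attained at a coordinate. -/
theorem exists_abs_coord_isometry_eq_one
    (U : TSpace (oneDiv n hn) schreier →ₗᵢ[ℝ] TSpace (oneDiv n hn) schreier) {i : ℕ+}
    (hi : i ≤ n) : ∃ m : ℕ+, m ≤ n ∧ |coord m (U (e i))| = 1 := by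
  have h0 := (oneDiv n hn).2.1.le
  have h1 := (oneDiv n hn).2.2.le
  have hz : ∀ m, n < m → coord m (U (e i)) = 0 := fun m hm =>
    coord_isometry_eq_zero U hm (hi.trans_lt hm)
  obtain ⟨m, hm, hmax⟩ := Finset.exists_max_image (Finset.Icc 1 n)
    (fun m => |coord m (U (e i))|) ⟨n, Finset.mem_Icc.mpr ⟨one_le, le_rfl⟩⟩
  refine ⟨m, (Finset.mem_Icc.mp hm).2, le_antisymm ?_ ?_⟩
  · simpa [norm_e] using abs_coord_le m (U (e i))
  · set x : ℕ+ →₀ ℝ := ∑ m ∈ Finset.Icc 1 n, coord m (U (e i)) • Finsupp.single m 1 with hx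
    have hUx : U (e i) = incl (oneDiv n hn) schreier x := by
      rw [hx, map_sum]
      simp only [map_smul, incl_single]
      refine eq_sum_coord _ fun m hm => hz m ?_
      by_contra! h
      exact hm (Finset.mem_Icc.mpr ⟨one_le, h⟩)
    have hxa : ∀ a, x a = coord a (U (e i)) := fun a => by rw [hUx, coord_incl]
    have hnorm : tNorm (oneDiv n hn : ℝ) schreier x ≤ |coord m (U (e i))| := by
      refine tNorm_le_of_tail (n := n) rfl (y := 0) (fun a ha => ?_) (fun a ha => ?_) ?_
      · rw [hxa]
        exact hmax a (Finset.mem_Icc.mpr ⟨one_le, ha⟩)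
      · rw [hxa, hz a ha]
        simp
      · exact (tNorm_zero h0 h1).trans_le (abs_nonneg _)
    rwa [← norm_incl, ← hUx, U.norm_map, norm_e] at hnorm

/-- A row of the matrix of an isometry that has an entry `±1` has no other nonzero entry, because
`‖e_i ± e_j‖ ≤ 1`. -/
theorem coord_isometry_eq_zero_of_abs_eq_one
    (U : TSpace (oneDiv n hn) schreier →ₗᵢ[ℝ] TSpace (oneDiv n hn) schreier) {i j m : ℕ+}
    (hij : i ≠ j) (h : |coord m (U (e i))| = 1) : coord m (U (e j)) = 0 := by
  have h0 := (oneDiv n hn).2.1.le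
  have h1 := (oneDiv n hn).2.2.le
  have hs : ∀ s : ℝ, |s| = 1 → |coord m (U (e i)) + s * coord m (U (e j))| ≤ 1 := by
    intro s hs
    have hnorm : ‖(e i : TSpace (oneDiv n hn) schreier) + s • e j‖ ≤ 1 := by
      rw [← incl_single, ← incl_single, ← map_smul, ← map_add, norm_incl]
      refine tNorm_le_max_l1 h0 h1 (fun a => ?_) ?_
      · rw [Finsupp.add_apply, Finsupp.smul_apply, Finsupp.single_apply, Finsupp.single_apply]
        split_ifs with hi hj hj
        · exact absurd (hi.trans hj.symm) hij
        · simp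
        · simp [hs]
        · simp
      · have h2 : l1 (Finsupp.single i 1 + s • Finsupp.single j 1) ≤ 2 := by
          refine (l1_add_le _ _).trans ?_
          rw [l1_smul, l1_single, l1_single, hs, abs_one]
          norm_num
        have h3 := mul_le_mul (oneDiv_le_half (hn := hn)) h2 (l1_nonneg _) (by norm_num)
        linarith
    have h2 := (abs_coord_le m (U (e i + s • e j))).trans ((U.norm_map _).trans_le hnorm)
    rwa [map_add, map_smul, map_add, map_smul, smul_eq_mul] at h2
  have hp := abs_le.mp (hs 1 abs_one)
  have hm := abs_le.mp (hs (-1) (by simp))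
  rcases eq_or_eq_neg_of_abs_eq h with h2 | h2 <;> rw [h2] at hp hm <;> linarith

theorem exists_actsBy_of_linearIsometryEquiv
    (V : TSpace (oneDiv n hn) schreier ≃ₗᵢ[ℝ] TSpace (oneDiv n hn) schreier) :
    ∃ (π : Equiv.Perm (Set.Icc 1 n)) (ε : ℕ+ → ℝ), (∀ i, ε i = 1 ∨ ε i = -1) ∧
      (∀ i : Set.Icc 1 n, V (e (i : ℕ+)) = ε i • e (π i : ℕ+)) ∧
        ∀ i : ℕ+, n + 1 ≤ i → V (e i) = ε i • e i := by
  have hrow : ∀ {i j m : ℕ+}, i ≠ j → |coord m (V (e i))| = 1 → coord m (V (e j)) = 0 :=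
    fun hij h => coord_isometry_eq_zero_of_abs_eq_one V.toLinearIsometry hij h
  have hex : ∀ i : Set.Icc 1 n, ∃ m : Set.Icc 1 n, |coord (m : ℕ+) (V (e (i : ℕ+)))| = 1 := by
    intro i
    obtain ⟨m, hm, h⟩ := exists_abs_coord_isometry_eq_one V.toLinearIsometry i.2.2
    exact ⟨⟨m, one_le, hm⟩, h⟩
  choose σ hσ using hex
  have hinj : Function.Injective σ := by
    intro i j hij
    by_contra hne
    have h := hrow (fun h => hne (Subtype.ext h)) (hσ i)
    have h2 := hσ j
    rw [← hij, h, abs_zero] at h2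
    exact zero_ne_one h2
  have hbij : Function.Bijective σ := Finite.injective_iff_bijective.mp hinj
  -- `τ i` is the row in which the column of `e_i` has its nonzero entry
  set τ : ℕ+ → ℕ+ := fun i => if h : i ∈ Set.Icc 1 n then σ ⟨i, h⟩ else i with hτ
  have hτmem : ∀ i : Set.Icc 1 n, τ i = σ i := fun i => dif_pos i.2
  have hτout : ∀ i, n < i → τ i = i := fun i hi => dif_neg fun h => not_lt.mpr h.2 hi
  have habs : ∀ i, |coord (τ i) (V (e i))| = 1 := fun i => by
    rcases le_or_gt i n with hi | hi
    · have := hσ ⟨i, one_le, hi⟩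
      rwa [← hτmem] at this
    · rw [hτout i hi]
      exact abs_coord_isometry_diag V hi
  have hsurj : Function.Surjective τ := fun m => by
    rcases le_or_gt m n with hm | hm
    · obtain ⟨i, hi⟩ := hbij.2 ⟨m, one_le, hm⟩
      exact ⟨i, by rw [hτmem, hi]⟩
    · exact ⟨m, hτout m hm⟩
  have hV : ∀ i, V (e i) = coord (τ i) (V (e i)) • e (τ i) := fun i => by
    refine eq_smul_e (τ i) fun m hm => ?_
    obtain ⟨j, rfl⟩ := hsurj m
    exact hrow (fun h => hm (by rw [h])) (habs j)
  refine ⟨Equiv.ofBijective σ hbij, fun i => coord (τ i) (V (e i)),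
    fun i => eq_or_eq_neg_of_abs_eq (habs i), fun i => ?_, fun i hi => ?_⟩
  · exact (hV i).trans (congrArg _ (congrArg e (hτmem i)))
  · exact (hV i).trans (congrArg _ (congrArg e (hτout i (PNat.add_one_le_iff.mp hi))))

end

end Tsirelson

theorem mainTheorem1 (n : ℕ+) (hn : 2 ≤ n) :
    (∀ U : Tsirelson.TSpace (Tsirelson.oneDiv n hn) Tsirelson.schreier →L[ℝ]
          Tsirelson.TSpace (Tsirelson.oneDiv n hn) Tsirelson.schreier,
      (Isometry U ∧ Function.Surjective U) ↔
        ∃ (π : Equiv.Perm (Set.Icc 1 n)) (ε : ℕ+ → ℝ),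
          (∀ i, ε i = 1 ∨ ε i = -1) ∧ Tsirelson.ActsBy n U π ε) ∧
    (∀ (π : Equiv.Perm (Set.Icc 1 n)) (ε : ℕ+ → ℝ), (∀ i, ε i = 1 ∨ ε i = -1) →
      ∃ U : Tsirelson.TSpace (Tsirelson.oneDiv n hn) Tsirelson.schreier →L[ℝ]
          Tsirelson.TSpace (Tsirelson.oneDiv n hn) Tsirelson.schreier,
        Isometry U ∧ Function.Surjective U ∧ Tsirelson.ActsBy n U π ε) := by
  refine ⟨fun U => ⟨?_, ?_⟩, fun π ε hε => ?_⟩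
  · rintro ⟨hiso, hsurj⟩
    exact Tsirelson.exists_actsBy_of_linearIsometryEquiv
      (LinearIsometryEquiv.ofSurjective (⟨U.toLinearMap, fun x => by
        simpa using! hiso.norm_map_of_map_zero (map_zero U) x⟩ :
        _ →ₗᵢ[ℝ] _) hsurj)
  · rintro ⟨π, ε, hε, hU⟩
    obtain ⟨V, hV⟩ := hU.exists_linearIsometryEquiv hε
    rw [hV]
    exact ⟨V.isometry, V.surjective⟩
  · obtain ⟨V, hV⟩ := Tsirelson.exists_linearIsometryEquiv (hn := hn) π ε hε
    exact ⟨V, V.isometry, V.surjective, hV⟩
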